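/- Let $\mathcal D$ be a probability distribution on a measurable space $\mathcal Z$, let $n\ge 1$, $d,T\ge 0$ be integers, let $\ell:\mathcal Z\times\mathbb R^d\to[0,1]$ be a measurable loss, and let $\tilde\ell:\mathcal Z\times\mathbb R^d\to\mathbb R$ be a measurable surrogate loss such that $\tilde\ell(z,\cdot)$ is differentiable for every $z$; $\nabla$ denotes the gradient in the second variable. Let $\eta_t>0$ (learning rates) and $\beta_t>0$ (inverse temperatures) be given for $0\le t<T$. Let the following be mutually independent: a super-sample $\tilde Z=(Z_{k,i})_{k\in\{1,2\},\,1\le i\le n}$ of i.i.d. elements with law $\mathcal D$; indices $U=(U_1,\dots,U_n)$ uniform on $\{1,2\}^n$; an index $J$ uniform on $\{1,\dots,n\}$; an initial point $W_0$ in $\mathbb R^d$ with arbitrary law; and i.i.d. noise vectors $\varepsilon_0,\varepsilon_1,\dots\sim\mathcal N(0,I_d)$. The training set is $S=(Z_{U_1,1},\dots,Z_{U_n,n})$. Write $$R_{\mathcal D}(w)=\mathbb E_{Z\sim\mathcal D}\,\ell(Z,w),\qquad \hat R_S(w)=\frac1n\sum_{i=1}^n\ell(Z_{U_i,i},w),\qquad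 \tilde R_S(w)=\frac1n\sum_{i=1}^n\tilde\ell(Z_{U_i,i},w).$$ The Langevin dynamics iterates are $$W_{t+1}=W_t-\eta_t\nabla\tilde R_S(W_t)+\sqrt{2\eta_t/\beta_t}\;\varepsilon_t,\qquad 0\le t<T.$$ Let $S_{J^c}$ be the training set with its $J$-th point removed, with $\tilde R_{S_{J^c}}(w)=\frac1{n-1}\sum_{i\ne J}\tilde\ell(Z_{U_i,i},w)$ (for $n=1$ this function is taken to be $0$). Define the two-sample incoherence $$\zeta_t=\nabla\tilde\ell(Z_{1,J},W_t)-\nabla\tilde\ell(Z_{2,J},W_t),$$ and, for $k\in\{1,2\}$ and $0\le t<T$ (so that $Y_{0,k}=0$), $$Y_{t,k}=\sum_{i=1}^{t}\frac{\beta_{i-1}}{4\eta_{i-1}}\Big\|W_i-W_{i-1}+\eta_{i-1}\frac{n-1}{n}\nabla\tilde R_{S_{J^c}}(W_{i-1})+\frac{\eta_{i-1}}{n}\nabla\tilde\ell(Z_{k,J},W_{i-1})\Big\|^2 .$$ Let $\Theta$ be the set of measurable functions $\theta:\mathbb R\to[0,1]$. Then $$\mathbb E\big[R_{\mathcal D}(W_T)-\hat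 R_S(W_T)\big]\;\le\;\frac{1}{n\sqrt2}\,\inf_{\theta\in\Theta}\,\mathbb E\sqrt{\sum_{t=0}^{T-1}\mathbb E\Big[\beta_t\eta_t\|\zeta_t\|^2\big(\mathbf 1_{\{U_J=1\}}-\theta(Y_{t,2}-Y_{t,1})\big)^2\,\Big|\,\tilde Z,U,J\Big]},$$ where expectations and conditional expectations of nonnegative quantities are taken in $[0,\infty]$. -/

import Mathlib

open MeasureTheory ProbabilityTheory
open scoped ENNReal Gradient

noncomputable section

namespace LangevinGen

variable {𝒵 : Type*} {n d : ℕ}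

/-- The training set `S = (Z_{U_1,1}, …, Z_{U_n,n})` selected from a `2 × n` super-sample by the
indices `u`. The two rows, numbered `1, 2` on paper, are numbered `0, 1` here. -/
def trainingSet (zt : Fin 2 → Fin n → 𝒵) (u : Fin n → Fin 2) : Fin n → 𝒵 :=
  fun i => zt (u i) i

/-- The risk `R_D(w) = E ℓ(Z, w)`, `Z ∼ D`. -/
def risk [MeasurableSpace 𝒵] (D : Measure 𝒵) (f : 𝒵 → EuclideanSpace ℝ (Fin d) → ℝ)
    (w : EuclideanSpace ℝ (Fin d)) : ℝ :=
  ∫ z, f z w ∂D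

/-- The empirical risk `|A|⁻¹ ∑_{i ∈ A} f(s_i, w)` of the subsample of `s` with indices in `A`.
The full empirical risk is the case `A = univ`. -/
def empRisk (f : 𝒵 → EuclideanSpace ℝ (Fin d) → ℝ) (s : Fin n → 𝒵) (A : Finset (Fin n))
    (w : EuclideanSpace ℝ (Fin d)) : ℝ :=
  (1 / (A.card : ℝ)) * ∑ i ∈ A, f (s i) w

/-- The iterates of Langevin dynamics on the training set `s`, with surrogate loss `sur`, learning
rates `η`, inverse temperatures `β`, initial point `w₀` and noise sequence `e`. -/
def ldIterate (sur : 𝒵 → EuclideanSpace ℝ (Fin d) → ℝ) (η β : ℕ → ℝ) (s : Fin n → 𝒵)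
    (w₀ : EuclideanSpace ℝ (Fin d)) (e : ℕ → EuclideanSpace ℝ (Fin d)) :
    ℕ → EuclideanSpace ℝ (Fin d)
  | 0 => w₀
  | t + 1 =>
      ldIterate sur η β s w₀ e t
        - η t • ∇ (empRisk sur s Finset.univ) (ldIterate sur η β s w₀ e t)
        + √(2 * η t / β t) • e t

/-- The two-sample incoherence `∇ℓ̃(Z_{1,j}, w) - ∇ℓ̃(Z_{2,j}, w)`. -/
def incoherence (sur : 𝒵 → EuclideanSpace ℝ (Fin d) → ℝ) (zt : Fin 2 → Fin n → 𝒵) (j : Fin n)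
    (w : EuclideanSpace ℝ (Fin d)) : EuclideanSpace ℝ (Fin d) :=
  ∇ (sur (zt 0 j)) w - ∇ (sur (zt 1 j)) w

/-- The statistic `Y_{t,k}` of a trajectory `w`: up to constants, the negative log-likelihood of
`w_1, …, w_t` under the hypothesis that `Z_{k,j}` is the `j`-th training point. -/
def testStat (sur : 𝒵 → EuclideanSpace ℝ (Fin d) → ℝ) (η β : ℕ → ℝ) (zt : Fin 2 → Fin n → 𝒵)
    (u : Fin n → Fin 2) (j : Fin n) (w : ℕ → EuclideanSpace ℝ (Fin d)) (t : ℕ) (k : Fin 2) : ℝ :=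
  ∑ i ∈ Finset.Icc 1 t, β (i - 1) / (4 * η (i - 1)) *
    ‖w i - w (i - 1)
      + (η (i - 1) * (((n : ℝ) - 1) / n)) •
          ∇ (empRisk sur (trainingSet zt u) (Finset.univ.erase j)) (w (i - 1))
      + (η (i - 1) / n) • ∇ (sur (zt k j)) (w (i - 1))‖ ^ 2

/-- The set `Θ` of decision functions: measurable functions `ℝ → [0,1]`. -/
def decisionFunctions : Set (ℝ → ℝ) :=
  {θ | Measurable θ ∧ ∀ x, θ x ∈ Set.Icc (0 : ℝ) 1}

/-- The joint law of the data and of the randomness of Langevin dynamics: a super-sample `Zt` with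
i.i.d. entries of law `D`, indices `U` uniform on `{1,2}^n`, an index `J` uniform on `{1, …, n}`, an
initial point `W₀` of arbitrary law, and i.i.d. standard Gaussian noise `ε`; the five are mutually
independent. -/
structure IsLDModel {Ω : Type*} [MeasurableSpace Ω] [MeasurableSpace 𝒵] (P : Measure Ω)
    (D : Measure 𝒵) (Zt : Ω → Fin 2 → Fin n → 𝒵) (U : Ω → Fin n → Fin 2) (J : Ω → Fin n)
    (W₀ : Ω → EuclideanSpace ℝ (Fin d)) (ε : ℕ → Ω → EuclideanSpace ℝ (Fin d)) : Prop where
  measurable_Zt : Measurable Zt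
  measurable_U : Measurable U
  measurable_J : Measurable J
  measurable_W₀ : Measurable W₀
  measurable_ε : ∀ t, Measurable (ε t)
  law_Zt : P.map Zt = Measure.pi fun _ => Measure.pi fun _ => D
  law_U : P.map U = uniformOn Set.univ
  law_J : P.map J = uniformOn Set.univ
  law_ε : ∀ t, P.map (ε t) = stdGaussian (EuclideanSpace ℝ (Fin d))
  indep_ε : iIndepFun ε P
  indep_Zt : IndepFun Zt (fun ω => (U ω, J ω, W₀ ω, fun t => ε t ω)) P
  indep_U : IndepFun U (fun ω => (J ω, W₀ ω, fun t => ε t ω)) P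
  indep_J : IndepFun J (fun ω => (W₀ ω, fun t => ε t ω)) P
  indep_W₀ : IndepFun W₀ (fun ω t => ε t ω) P

end LangevinGen

end

noncomputable section

namespace LangevinGen

/-! ### Translation of Gaussian measures -/

/-! The unselected entry of column `J` is independent of the training set, so the expected gap is
the mean of the loss at that entry minus the loss at the selected entry
(`integral_risk_sub_empRisk`). Given the super-sample, `J` and the other indices, `U_J` is a fair
coin. Pair each selection `u` with its flip `u'` at `J`: the loss difference `f` changes sign, so a
pair contributes `E f(W_T^u) - E f(W_T^{u'})` with `|f| ≤ 1`.

Both terms are compared with one reference dynamics that does not see the coin: it replaces the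
gradient at the `J`-th training point by the mixture of the two candidate gradients with weights `θ`
and `1 - θ`, evaluated at `Y_2 - Y_1` of its own trajectory. This difference is updated from the
last transition alone, so joined to the iterate it gives a Markov state. In this state space the
Langevin dynamics is the reference recursion with translated noise (`ldState_succ_eq_refStep`), and
the translation has squared length `(1/(n√2))² β η ‖ζ‖² (1_{U_J=1} - θ)²` (`norm_driftGap_sq`).

By the chain rule the relative entropy of the two chains is half the expected sum of these squared
lengths, and Pinsker's inequality for `|f| ≤ 1` turns it into the square root in the theorem
(`IsGaussianChain.ofReal_integral_sub_le`). No measure on path space is formed: the Donsker–Varadhan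
bound for one translated Gaussian is iterated over the steps. Passing from `u` to `u'` through the
reference costs one such root for each; averaging over the pair removes the factor two
(`ofReal_integral_le_of_symm`). Since the data are independent of the initial point and the noise,
integrating the latter out gives the conditional expectations. -/

lemma lintegral_gaussianReal_shift (c : ℝ) {f : ℝ → ℝ≥0∞} (hf : Measurable f) :
    ∫⁻ x, f (x + c) * ENNReal.ofReal (Real.exp (-(c * x) - c ^ 2 / 2)) ∂gaussianReal 0 1
      = ∫⁻ x, f x ∂gaussianReal 0 1 := by
  rw [gaussianReal_of_var_ne_zero _ one_ne_zero,
    lintegral_withDensity_eq_lintegral_mul _ (by fun_prop) (by fun_prop),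
    lintegral_withDensity_eq_lintegral_mul _ (by fun_prop) (by fun_prop),
    ← lintegral_add_right_eq_self (fun x => (gaussianPDF 0 1 * f) x) c]
  -- After translating the Lebesgue integral, only the pointwise identity between the density at `x
  -- + c` and the density at `x` times the exponential factor remains.
  refine lintegral_congr fun x => ?_
  simp only [Pi.mul_apply, gaussianPDF]
  rw [mul_comm (f _), ← mul_assoc, ← ENNReal.ofReal_mul (gaussianPDFReal_nonneg _ _ _)]
  congr 2
  simp only [gaussianPDFReal]
  rw [mul_assoc, ← Real.exp_add]
  congr 2
  simp
  ring

lemma lintegral_pi_prod {ι : Type*} [Fintype ι] (μ : ι → Measure ℝ)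
    [∀ i, IsProbabilityMeasure (μ i)] {f : ι → ℝ → ℝ≥0∞} (hf : ∀ i, Measurable (f i)) :
    ∫⁻ x, ∏ i, f i (x i) ∂Measure.pi μ = ∏ i, ∫⁻ x, f i x ∂μ i := by
  have h := lintegral_prod_eq_prod_lintegral_of_indepFun (μ := Measure.pi μ) Finset.univ
    (fun i x => f i (x i)) (iIndepFun_pi fun i => (hf i).aemeasurable)
    (fun i => (hf i).comp (measurable_pi_apply i))
  rw [h]
  refine Finset.prod_congr rfl fun i _ => ?_
  exact (measurePreserving_eval μ i).lintegral_comp (hf i)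

/-- A product measure is determined by its values on boxes. There the indicator and the density both
factor over coordinates, which reduces the claim to dimension one. -/
lemma pi_gaussianReal_eq_map_withDensity {ι : Type*} [Fintype ι] (c : ι → ℝ) :
    ((Measure.pi fun _ : ι => gaussianReal 0 1).withDensity
      fun x => ∏ i, ENNReal.ofReal (Real.exp (-(c i * x i) - c i ^ 2 / 2))).map (fun x => x + c)
      = Measure.pi fun _ : ι => gaussianReal 0 1 := by
  refine (Measure.pi_eq fun s hs => ?_).symm
  have hpi := MeasurableSet.univ_pi hs
  rw [Measure.map_apply (by fun_prop) hpi,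
    withDensity_apply _ (hpi.preimage (by fun_prop)),
    ← lintegral_indicator (hpi.preimage (by fun_prop))]
  have : ∀ x : ι → ℝ, ((fun x => x + c) ⁻¹' Set.pi Set.univ s).indicator
      (fun x => ∏ i, ENNReal.ofReal (Real.exp (-(c i * x i) - c i ^ 2 / 2))) x
      = ∏ i, (s i).indicator 1 (x i + c i)
          * ENNReal.ofReal (Real.exp (-(c i * x i) - c i ^ 2 / 2)) := by
    intro x
    rw [Finset.prod_mul_distrib]
    by_cases hx : x ∈ (fun x => x + c) ⁻¹' Set.pi Set.univ s
    · have h1 : ∏ i, (s i).indicator (1 : ℝ → ℝ≥0∞) (x i + c i) = 1 :=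
        Finset.prod_eq_one fun i _ => Set.indicator_of_mem (hx i trivial) _
      rw [Set.indicator_of_mem hx, h1, one_mul]
    · rw [Set.indicator_of_notMem hx]
      simp only [Set.mem_preimage, Set.mem_pi, Set.mem_univ, forall_const, not_forall] at hx
      obtain ⟨i, hi⟩ := hx
      rw [Finset.prod_eq_zero (Finset.mem_univ i) (Set.indicator_of_notMem hi _), zero_mul]
  simp_rw [this]
  rw [lintegral_pi_prod (fun _ : ι => gaussianReal 0 1)
    (f := fun i y => (s i).indicator 1 (y + c i)
          * ENNReal.ofReal (Real.exp (-(c i * y) - c i ^ 2 / 2)))]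
  · refine Finset.prod_congr rfl fun i _ => ?_
    rw [lintegral_gaussianReal_shift (c i) (measurable_one.indicator (hs i)),
      lintegral_indicator_one (hs i)]
  · intro i
    have := measurable_one.indicator (hs i) (β := ℝ≥0∞)
    fun_prop

/-- The Cameron–Martin formula, obtained from the coordinate version by collecting the exponents
into an inner product and a norm. In `[0,∞]` it needs no integrability, and below it even yields
some. -/
lemma lintegral_stdGaussian_shift {d : ℕ} (c : EuclideanSpace ℝ (Fin d))
    {f : EuclideanSpace ℝ (Fin d) → ℝ≥0∞} (hf : Measurable f) :
    ∫⁻ x, f (x + c) * ENNReal.ofReal (Real.exp (-inner ℝ c x - ‖c‖ ^ 2 / 2))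
        ∂stdGaussian (EuclideanSpace ℝ (Fin d))
      = ∫⁻ x, f x ∂stdGaussian (EuclideanSpace ℝ (Fin d)) := by
  rw [← map_pi_eq_stdGaussian, lintegral_map (by fun_prop) (by fun_prop),
    lintegral_map hf (by fun_prop)]
  conv_rhs => rw [← pi_gaussianReal_eq_map_withDensity fun i => c i]
  rw [lintegral_map (by fun_prop) (by fun_prop),
    lintegral_withDensity_eq_lintegral_mul _ (by fun_prop) (by fun_prop)]
  refine lintegral_congr fun x => ?_
  rw [Pi.mul_apply, mul_comm]
  congr 1
  rw [← ENNReal.ofReal_prod_of_nonneg (fun _ _ => (Real.exp_pos _).le), ← Real.exp_sum]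
  congr 2
  rw [EuclideanSpace.real_norm_sq_eq, PiLp.inner_apply, Finset.sum_sub_distrib, Finset.sum_div,
    Finset.sum_neg_distrib]
  simp [mul_comm]

/-- The variational bound for a translated standard Gaussian: an average over the law centred
at `0` exceeds a log-Laplace transform over the law centred at `-c` by at most `‖c‖² / 2`, their
relative entropy. -/
lemma integral_stdGaussian_le_log_integral_exp {d : ℕ} (c : EuclideanSpace ℝ (Fin d))
    {f : EuclideanSpace ℝ (Fin d) → ℝ} (hf : Measurable f) {M : ℝ} (hM : ∀ x, |f x| ≤ M) :
    ∫ x, f (x + c) ∂stdGaussian (EuclideanSpace ℝ (Fin d))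
      ≤ ‖c‖ ^ 2 / 2 + Real.log (∫ x, Real.exp (f x) ∂stdGaussian (EuclideanSpace ℝ (Fin d))) := by
  set γ := stdGaussian (EuclideanSpace ℝ (Fin d))
  have hfi : Integrable (fun x => f (x + c)) γ :=
    Integrable.of_bound (hf.comp (measurable_add_const c)).aestronglyMeasurable M
      (Filter.Eventually.of_forall fun x => by simpa using hM _)
  have hexp : Integrable (fun x => Real.exp (f x)) γ :=
    Integrable.of_bound (by fun_prop) (Real.exp M) (Filter.Eventually.of_forall fun x => by
      rw [Real.norm_eq_abs, abs_of_pos (Real.exp_pos _)]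
      exact Real.exp_le_exp.2 ((le_abs_self _).trans (hM x)))
  have hinner : Integrable (fun x => inner ℝ c x) γ :=
    (innerSL ℝ c).integrable_comp IsGaussian.integrable_id
  have hinner0 : ∫ x, inner ℝ c x ∂γ = 0 := integral_strongDual_stdGaussian (innerSL ℝ c)
  -- `h` adds to `f (x + c)` the logarithm of the Cameron–Martin density, whose mean is `-‖c‖² / 2`.
  -- The translation formula gives `E exp h = E exp f`, and Jensen's inequality for `exp` applied to
  -- `h` is the claim.
  set h := fun x => f (x + c) + (-inner ℝ c x - ‖c‖ ^ 2 / 2)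
  have hmh : Measurable h := by fun_prop
  have hh : Integrable h γ := hfi.add (hinner.neg.sub (integrable_const _))
  have hlin : ∫⁻ x, ENNReal.ofReal (Real.exp (h x)) ∂γ
      = ∫⁻ x, ENNReal.ofReal (Real.exp (f x)) ∂γ := by
    rw [← lintegral_stdGaussian_shift c (f := fun x => ENNReal.ofReal (Real.exp (f x)))
      (by fun_prop)]
    refine lintegral_congr fun x => ?_
    rw [← ENNReal.ofReal_mul (Real.exp_pos _).le, ← Real.exp_add]
  have hhe : Integrable (fun x => Real.exp (h x)) γ := by
    refine ⟨by fun_prop, ?_⟩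
    rw [hasFiniteIntegral_iff_ofReal (Filter.Eventually.of_forall fun x => (Real.exp_pos _).le),
      hlin]
    exact (hasFiniteIntegral_iff_ofReal
      (Filter.Eventually.of_forall fun x => (Real.exp_pos _).le)).1 hexp.2
  have hint : ∫ x, Real.exp (h x) ∂γ = ∫ x, Real.exp (f x) ∂γ := by
    rw [integral_eq_lintegral_of_nonneg_ae (Filter.Eventually.of_forall fun x => (Real.exp_pos _).le)
      (by fun_prop), hlin, integral_eq_lintegral_of_nonneg_ae
      (Filter.Eventually.of_forall fun x => (Real.exp_pos _).le) (by fun_prop)]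
  have hj : Real.exp (∫ x, h x ∂γ) ≤ ∫ x, Real.exp (h x) ∂γ :=
    convexOn_exp.map_integral_le Real.continuous_exp.continuousOn isClosed_univ
      (Filter.Eventually.of_forall fun _ => trivial) hh hhe
  rw [hint] at hj
  have hih : ∫ x, h x ∂γ = ∫ x, f (x + c) ∂γ - ‖c‖ ^ 2 / 2 := by
    have h1 : Integrable (fun x => -inner ℝ c x - ‖c‖ ^ 2 / 2) γ :=
      hinner.neg.sub (integrable_const _)
    have h2 : Integrable (fun x => -inner ℝ c x) γ := hinner.neg
    simp only [h]
    rw [integral_add hfi h1, integral_sub h2 (integrable_const _), integral_neg, hinner0]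
    simp [sub_eq_add_neg]
  have := (Real.le_log_iff_exp_le ((Real.exp_pos _).trans_le hj)).2 hj
  linarith

/-! ### Comparison of Markov chains driven by Gaussian noise -/

section Chains

variable {Ω 𝒮 : Type*} [MeasurableSpace Ω] [MeasurableSpace 𝒮] {P : Measure Ω}
  {d : ℕ}

/-- `X` is a Markov chain with transitions `X_{t+1} = G_t(X_t, ε_t + c_t(X_t))` for `t < T`, the
noise `ε_t` being standard Gaussian and independent of `X_t`. -/
structure IsGaussianChain (P : Measure Ω) (ε : ℕ → Ω → EuclideanSpace ℝ (Fin d))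
    (G : ℕ → 𝒮 → EuclideanSpace ℝ (Fin d) → 𝒮) (c : ℕ → 𝒮 → EuclideanSpace ℝ (Fin d))
    (X : ℕ → Ω → 𝒮) (T : ℕ) : Prop where
  measurable_chain : ∀ t, Measurable (X t)
  measurable_noise : ∀ t, Measurable (ε t)
  law_noise : ∀ t, P.map (ε t) = stdGaussian (EuclideanSpace ℝ (Fin d))
  indep : ∀ t, IndepFun (X t) (ε t) P
  measurable_step : ∀ t, Measurable (Function.uncurry (G t))
  measurable_drift : ∀ t, Measurable (c t)
  step : ∀ t < T, ∀ ω, X (t + 1) ω = G t (X t ω) (ε t ω + c t (X t ω))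

variable {ε : ℕ → Ω → EuclideanSpace ℝ (Fin d)} {G : ℕ → 𝒮 → EuclideanSpace ℝ (Fin d) → 𝒮}
  {c : ℕ → 𝒮 → EuclideanSpace ℝ (Fin d)} {X X' : ℕ → Ω → 𝒮} {T : ℕ}

lemma IsGaussianChain.mono (hX : IsGaussianChain P ε G c X T) {T' : ℕ} (h : T' ≤ T) :
    IsGaussianChain P ε G c X T' :=
  { hX with step := fun t ht => hX.step t (ht.trans_le h) }

variable [IsProbabilityMeasure P]

lemma integral_comp_prod_of_indepFun {A B : Type*} [MeasurableSpace A] [MeasurableSpace B]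
    {X : Ω → A} {Y : Ω → B} (hX : Measurable X) (hY : Measurable Y) (h : IndepFun X Y P)
    {g : A × B → ℝ} (hg : Measurable g) {M : ℝ} (hM : ∀ p, |g p| ≤ M) :
    ∫ ω, g (X ω, Y ω) ∂P = ∫ ω, ∫ y, g (X ω, y) ∂(P.map Y) ∂P := by
  have := Measure.isProbabilityMeasure_map (μ := P) hX.aemeasurable
  have := Measure.isProbabilityMeasure_map (μ := P) hY.aemeasurable
  rw [← integral_map (φ := fun ω => (X ω, Y ω)) (f := g) (by fun_prop) (by fun_prop),
    (indepFun_iff_map_prod_eq_prod_map_map hX.aemeasurable hY.aemeasurable).1 h, integral_prod]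
  · rw [integral_map (f := fun x => ∫ y, g (x, y) ∂(P.map Y)) hX.aemeasurable]
    exact (StronglyMeasurable.integral_prod_right'
      hg.stronglyMeasurable).aestronglyMeasurable
  · exact Integrable.of_bound (by fun_prop) M (Filter.Eventually.of_forall fun p => by
      simpa using hM p)

namespace IsGaussianChain

lemma integral_step (hX : IsGaussianChain P ε G c X T) {t : ℕ} (ht : t < T)
    {f : 𝒮 → ℝ} (hf : Measurable f)
    {M : ℝ} (hM : ∀ s, |f s| ≤ M) :
    ∫ ω, f (X (t + 1) ω) ∂P
      = ∫ ω, ∫ x, f (G t (X t ω) (x + c t (X t ω))) ∂stdGaussian (EuclideanSpace ℝ (Fin d)) ∂P := by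
  have hm : Measurable fun p : 𝒮 × EuclideanSpace ℝ (Fin d) => f (G t p.1 (p.2 + c t p.1)) := by
    have h1 := hX.measurable_step t
    have h2 := hX.measurable_drift t
    exact hf.comp (h1.comp (measurable_fst.prodMk
      (measurable_snd.add (h2.comp measurable_fst))))
  simp_rw [hX.step t ht]
  have := integral_comp_prod_of_indepFun (hX.measurable_chain t) (hX.measurable_noise t)
    (hX.indep t) hm (M := M) fun p => hM _
  rw [hX.law_noise] at this
  exact this

/-- The Donsker–Varadhan bound with the relative entropy already expanded by the chain rule. The
induction on `T` runs over all bounded `f`: integrating the last noise out of `exp f` leaves a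
function of the state at time `T`, whose logarithm is the test function for the shorter chain. -/
lemma integral_le_log_integral_exp (hX : IsGaussianChain P ε G c X T)
    (hX' : IsGaussianChain P ε G (fun _ _ => 0) X' T) (h0 : X 0 = X' 0)
    (hc : ∀ t < T, Integrable (fun ω => ‖c t (X t ω)‖ ^ 2 / 2) P)
    {f : 𝒮 → ℝ} (hf : Measurable f) {M : ℝ} (hM : ∀ s, |f s| ≤ M) :
    ∫ ω, f (X T ω) ∂P ≤ (∑ t ∈ Finset.range T, ∫ ω, ‖c t (X t ω)‖ ^ 2 / 2 ∂P)
      + Real.log (∫ ω, Real.exp (f (X' T ω)) ∂P) := by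
  induction T generalizing f with
  | zero =>
    have hm : Measurable fun ω => f (X 0 ω) := hf.comp (hX.measurable_chain 0)
    have hi : Integrable (fun ω => f (X 0 ω)) P :=
      Integrable.of_bound hm.aestronglyMeasurable M
        (Filter.Eventually.of_forall fun ω => by simpa using hM _)
    have he : Integrable (fun ω => Real.exp (f (X 0 ω))) P :=
      Integrable.of_bound hm.exp.aestronglyMeasurable (Real.exp M) (Filter.Eventually.of_forall fun x => by
        rw [Real.norm_eq_abs, abs_of_pos (Real.exp_pos _)]
        exact Real.exp_le_exp.2 ((le_abs_self _).trans (hM _)))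
    have hj : Real.exp (∫ ω, f (X 0 ω) ∂P) ≤ ∫ ω, Real.exp (f (X 0 ω)) ∂P :=
      convexOn_exp.map_integral_le Real.continuous_exp.continuousOn isClosed_univ
        (Filter.Eventually.of_forall fun _ => trivial) hi he
    rw [← h0]
    simpa using (Real.le_log_iff_exp_le ((Real.exp_pos _).trans_le hj)).2 hj
  | succ T ih =>
    set γ := stdGaussian (EuclideanSpace ℝ (Fin d))
    have hGm := hX.measurable_step T
    have hcm := hX.measurable_drift T
    have hfG : Measurable fun p : 𝒮 × EuclideanSpace ℝ (Fin d) => f (G T p.1 p.2) := hf.comp hGm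
    have hfGs : ∀ s, Measurable fun x => f (G T s x) := fun s =>
      hfG.comp (measurable_const.prodMk measurable_id)
    have heb : ∀ s, Real.exp (f s) ∈ Set.Icc (Real.exp (-M)) (Real.exp M) := fun s =>
      ⟨Real.exp_le_exp.2 (neg_le_of_abs_le (hM s)), Real.exp_le_exp.2 (le_of_abs_le (hM s))⟩
    have hei : ∀ s, Integrable (fun x => Real.exp (f (G T s x))) γ := fun s =>
      Integrable.of_bound (hfGs s).exp.aestronglyMeasurable (Real.exp M)
        (Filter.Eventually.of_forall fun x => by
          rw [Real.norm_eq_abs, abs_of_pos (Real.exp_pos _)]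
          exact (heb _).2)
    set u : 𝒮 → ℝ := fun s => ∫ x, Real.exp (f (G T s x)) ∂γ
    have hu : ∀ s, u s ∈ Set.Icc (Real.exp (-M)) (Real.exp M) := fun s => by
      constructor
      · simpa using integral_mono (integrable_const (μ := γ) (Real.exp (-M))) (hei s)
          fun x => (heb _).1
      · simpa using integral_mono (hei s) (integrable_const (μ := γ) (Real.exp M))
          fun x => (heb _).2
    have hupos : ∀ s, 0 < u s := fun s => (Real.exp_pos _).trans_le (hu s).1
    have hum : Measurable u :=
      (StronglyMeasurable.integral_prod_right (ν := γ) hfG.exp.stronglyMeasurable).measurable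
    -- The bound `M` survives the passage to the new test function, so the induction hypothesis
    -- applies to it.
    have hlog : ∀ s, |Real.log (u s)| ≤ M := fun s => abs_le.2
      ⟨(Real.le_log_iff_exp_le (hupos s)).2 (hu s).1,
        (Real.log_le_iff_le_exp (hupos s)).2 (hu s).2⟩
    have hih := ih (hX.mono T.le_succ) (hX'.mono T.le_succ)
      (fun t ht => hc t (ht.trans T.lt_succ_self)) hum.log hlog
    simp_rw [Real.exp_log (hupos _)] at hih
    have h' : ∫ ω, Real.exp (f (X' (T + 1) ω)) ∂P = ∫ ω, u (X' T ω) ∂P := by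
      rw [hX'.integral_step T.lt_succ_self hf.exp (M := Real.exp M) fun s => by
        rw [abs_of_pos (Real.exp_pos _)]
        exact (heb s).2]
      simp [u, γ]
    have hli : Integrable (fun ω => Real.log (u (X T ω))) P :=
      Integrable.of_bound (hum.log.comp (hX.measurable_chain T)).aestronglyMeasurable M
        (Filter.Eventually.of_forall fun ω => by simpa using hlog _)
    have hstep : ∫ ω, f (X (T + 1) ω) ∂P
        ≤ ∫ ω, ‖c T (X T ω)‖ ^ 2 / 2 ∂P + ∫ ω, Real.log (u (X T ω)) ∂P := by
      rw [hX.integral_step T.lt_succ_self hf hM, ← integral_add (hc T T.lt_succ_self) hli]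
      have hm : Measurable fun p : 𝒮 × EuclideanSpace ℝ (Fin d) =>
          f (G T p.1 (p.2 + c T p.1)) :=
        hfG.comp (measurable_fst.prodMk (measurable_snd.add (hcm.comp measurable_fst)))
      refine integral_mono (Integrable.of_bound (((StronglyMeasurable.integral_prod_right' (ν := γ)
        hm.stronglyMeasurable).measurable.comp (hX.measurable_chain T)).aestronglyMeasurable) M
        (Filter.Eventually.of_forall fun ω => ?_)) ((hc T T.lt_succ_self).add hli) fun ω =>
          integral_stdGaussian_le_log_integral_exp (c T (X T ω)) (hfGs (X T ω)) fun x => hM _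
      simpa using norm_integral_le_of_norm_le_const (μ := γ) (C := M)
        (f := fun x => f (G T (X T ω) (x + c T (X T ω)))) (Filter.Eventually.of_forall fun x => hM _)
    rw [Finset.sum_range_succ, h']
    linarith

/-- Pinsker's inequality for two Gaussian chains whose drifts differ by `c`. -/
lemma ofReal_integral_sub_le (hX : IsGaussianChain P ε G c X T)
    (hX' : IsGaussianChain P ε G (fun _ _ => 0) X' T) (h0 : X 0 = X' 0)
    {f : 𝒮 → ℝ} (hf : Measurable f) (hM : ∀ s, |f s| ≤ 1) :
    ENNReal.ofReal (∫ ω, f (X T ω) ∂P - ∫ ω, f (X' T ω) ∂P)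
      ≤ (∑ t ∈ Finset.range T, ∫⁻ ω, ENNReal.ofReal (‖c t (X t ω)‖ ^ 2) ∂P) ^ (1 / 2 : ℝ) := by
  set K := ∑ t ∈ Finset.range T, ∫⁻ ω, ENNReal.ofReal (‖c t (X t ω)‖ ^ 2) ∂P
  -- If the sum is infinite the bound is trivial; otherwise every squared drift is integrable and
  -- the real-valued bound applies.
  by_cases hK : K = ∞
  · simp [hK]
  set Δ := ∫ ω, f (X T ω) ∂P - ∫ ω, f (X' T ω) ∂P
  have hmc : ∀ t, Measurable fun ω => ‖c t (X t ω)‖ ^ 2 := fun t =>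
    ((hX.measurable_drift t).comp (hX.measurable_chain t)).norm.pow_const 2
  have hi : ∀ t < T, Integrable (fun ω => ‖c t (X t ω)‖ ^ 2) P := fun t ht => by
    refine ⟨(hmc t).aestronglyMeasurable, ?_⟩
    rw [hasFiniteIntegral_iff_ofReal (Filter.Eventually.of_forall fun ω => sq_nonneg _)]
    exact (ENNReal.sum_ne_top.1 hK t (Finset.mem_range.2 ht)).lt_top
  have hKr : K = ENNReal.ofReal (∑ t ∈ Finset.range T, ∫ ω, ‖c t (X t ω)‖ ^ 2 ∂P) := by
    rw [ENNReal.ofReal_sum_of_nonneg fun t _ => integral_nonneg fun ω => sq_nonneg _]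
    refine Finset.sum_congr rfl fun t ht => ?_
    rw [ofReal_integral_eq_lintegral_ofReal (hi t (Finset.mem_range.1 ht))
      (Filter.Eventually.of_forall fun ω => sq_nonneg _)]
  set k := ∑ t ∈ Finset.range T, ∫ ω, ‖c t (X t ω)‖ ^ 2 ∂P
  -- For `Δ > 0` the test function is `Δ f`, `Δ` itself being the best multiplier. Hoeffding's lemma
  -- on `[-1, 1]` bounds the log-Laplace transform by `Δ m + Δ² / 2`, so `Δ² ≤ k / 2 + Δ² / 2`.
  have key : Δ ^ 2 ≤ k ∨ Δ ≤ 0 := by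
    refine or_iff_not_imp_right.2 fun hΔ => ?_
    push Not at hΔ
    have h1 := hX.integral_le_log_integral_exp hX' h0
      (fun t ht => (hi t ht).div_const 2) (hf.const_mul Δ) (M := Δ) fun s => by
        rw [abs_mul, abs_of_pos hΔ]
        exact mul_le_of_le_one_right hΔ.le (hM s)
    simp_rw [integral_div, ← Finset.sum_div, integral_const_mul] at h1
    set m := ∫ ω, f (X' T ω) ∂P
    have hsg := (hasSubgaussianMGF_of_mem_Icc (μ := P) (a := -1) (b := 1)
      (hf.comp (hX'.measurable_chain T)).aemeasurable
      (Filter.Eventually.of_forall fun ω => abs_le.1 (hM (X' T ω)))).mgf_le Δ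
    have hexp : ∫ ω, Real.exp (Δ * f (X' T ω)) ∂P ≤ Real.exp (Δ * m + Δ ^ 2 / 2) := by
      have h2 : ∀ ω, Real.exp (Δ * f (X' T ω))
          = Real.exp (Δ * m) * Real.exp (Δ * (f (X' T ω) - m)) := fun ω => by
        rw [← Real.exp_add]; ring_nf
      simp_rw [h2]
      rw [integral_const_mul, Real.exp_add]
      refine mul_le_mul_of_nonneg_left (hsg.trans (Real.exp_le_exp.2 (le_of_eq ?_)))
        (Real.exp_pos _).le
      norm_num
    have hpos : 0 < ∫ ω, Real.exp (Δ * f (X' T ω)) ∂P := integral_exp_pos <|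
      Integrable.of_bound
        (((hf.comp (hX'.measurable_chain T)).const_mul Δ).exp).aestronglyMeasurable (Real.exp Δ)
        (Filter.Eventually.of_forall fun ω => by
          rw [Real.norm_eq_abs, abs_of_pos (Real.exp_pos _)]
          exact Real.exp_le_exp.2 (mul_le_of_le_one_right hΔ.le (le_of_abs_le (hM _))))
    have h3 := (Real.log_le_iff_le_exp hpos).2 hexp
    have h4 : Δ * Δ = Δ * ∫ ω, f (X T ω) ∂P - Δ * m := by rw [← mul_sub]
    nlinarith
  rw [hKr, ENNReal.ofReal_rpow_of_nonneg
    (Finset.sum_nonneg fun t _ => integral_nonneg fun ω => sq_nonneg _) (by norm_num),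
    ← Real.sqrt_eq_rpow]
  refine ENNReal.ofReal_le_ofReal ?_
  rcases key with h | h
  · exact Real.le_sqrt_of_sq_le h
  · exact h.trans (Real.sqrt_nonneg _)

end IsGaussianChain

end Chains

/-! ### Independence -/

section Independence

variable {Ω A B C : Type*} [MeasurableSpace Ω] [MeasurableSpace A] [MeasurableSpace B]
  [MeasurableSpace C] {P : Measure Ω} [IsProbabilityMeasure P]

lemma indepFun_prodMk_of_indepFun {X : Ω → A} {Y : Ω → B} {Z : Ω → C} (hX : Measurable X)
    (hY : Measurable Y) (hZ : Measurable Z) (h : IndepFun X (fun ω => (Y ω, Z ω)) P)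
    (h' : IndepFun Y Z P) : IndepFun (fun ω => (X ω, Y ω)) Z P := by
  have := Measure.isProbabilityMeasure_map (μ := P) hX.aemeasurable
  have := Measure.isProbabilityMeasure_map (μ := P) hY.aemeasurable
  have := Measure.isProbabilityMeasure_map (μ := P) hZ.aemeasurable
  have hXY : IndepFun X Y P := h.comp measurable_id measurable_fst
  rw [indepFun_iff_map_prod_eq_prod_map_map (by fun_prop) (by fun_prop)] at h h' hXY ⊢
  rw [hXY, ← (measurePreserving_prodAssoc (P.map X) (P.map Y) (P.map Z)).symm.map_eq, ← h', ← h,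
    Measure.map_map (by fun_prop) (by fun_prop)]
  rfl

/-- The state at time `t` is a measurable function of `W₀` and of the noises with index below `t`,
and these are jointly independent of `ε t`. -/
lemma indepFun_of_recursion {𝒮 : Type*} [MeasurableSpace 𝒮] {W₀ : Ω → A} {ε : ℕ → Ω → B}
    (hW₀ : Measurable W₀) (hε : ∀ t, Measurable (ε t)) (hind : iIndepFun ε P)
    (hind₀ : IndepFun W₀ (fun ω t => ε t ω) P) {H : ℕ → 𝒮 → B → 𝒮}
    (hH : ∀ t, Measurable (Function.uncurry (H t))) {φ : A → 𝒮} (hφ : Measurable φ)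
    {X : ℕ → Ω → 𝒮} (h0 : ∀ ω, X 0 ω = φ (W₀ ω)) (hX : ∀ t ω, X (t + 1) ω = H t (X t ω) (ε t ω))
    (t : ℕ) : Measurable (X t) ∧ IndepFun (X t) (ε t) P := by
  have key : ∃ Ψ : A × (Finset.range t → B) → 𝒮, Measurable Ψ ∧
      ∀ ω, X t ω = Ψ (W₀ ω, fun i => ε i ω) := by
    induction t with
    | zero => exact ⟨fun p => φ p.1, hφ.comp measurable_fst, h0⟩
    | succ t ih =>
      obtain ⟨Ψ, hΨ, h⟩ := ih
      refine ⟨fun p => H t (Ψ (p.1, fun i => p.2 ⟨i, Finset.range_subset_range.2 t.le_succ i.2⟩))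
        (p.2 ⟨t, Finset.self_mem_range_succ t⟩), ?_, fun ω => by rw [hX, h]⟩
      exact (hH t).comp ((hΨ.comp (by fun_prop)).prodMk (by fun_prop))
  obtain ⟨Ψ, hΨ, h⟩ := key
  have hpast : Measurable fun ω => fun i : Finset.range t => ε i ω :=
    measurable_pi_lambda _ fun i => hε i
  have hX' : X t = Ψ ∘ fun ω => (W₀ ω, fun i : Finset.range t => ε i ω) := funext h
  refine ⟨hX' ▸ hΨ.comp (hW₀.prodMk hpast), ?_⟩
  have h1 : IndepFun (fun ω => fun i : Finset.range t => ε i ω) (ε t) P :=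
    (hind.indepFun_finset (Finset.range t) {t} (by simp) hε).comp measurable_id
      (measurable_pi_apply (⟨t, Finset.mem_singleton_self t⟩ : ({t} : Finset ℕ)))
  have h2 : IndepFun W₀ (fun ω => (fun i : Finset.range t => ε i ω, ε t ω)) P :=
    hind₀.comp (φ := id) (ψ := fun e : ℕ → B => (fun i : Finset.range t => e i, e t))
      measurable_id (by fun_prop)
  rw [hX']
  exact (indepFun_prodMk_of_indepFun hW₀ hpast (hε t) h2 h1).comp hΨ measurable_id

/-- The freezing lemma: by Tonelli for the product law, the integral over `Y` with `X` held fixed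
has the right integral over every event generated by `X`. -/
lemma condLExp_comp_prod_of_indepFun {X : Ω → A} {Y : Ω → B} (hX : Measurable X)
    (hY : Measurable Y) (h : IndepFun X Y P) {f : A × B → ℝ≥0∞} (hf : Measurable f) :
    P⁻[fun ω => f (X ω, Y ω) | MeasurableSpace.comap X inferInstance]
      =ᵐ[P] fun ω => ∫⁻ ω', f (X ω, Y ω') ∂P := by
  have := Measure.isProbabilityMeasure_map (μ := P) hX.aemeasurable
  have := Measure.isProbabilityMeasure_map (μ := P) hY.aemeasurable
  have hm : Measurable fun x => ∫⁻ y, f (x, y) ∂(P.map Y) := hf.lintegral_prod_right'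
  have hfx : ∀ x, ∫⁻ ω', f (x, Y ω') ∂P = ∫⁻ y, f (x, y) ∂(P.map Y) := fun x =>
    (lintegral_map (hf.comp measurable_prodMk_left) hY).symm
  simp_rw [hfx]
  refine (ae_eq_condLExp hX.comap_le P _ (hm.comp (comap_measurable X)) ?_).symm
  rintro _ ⟨s, hs, rfl⟩
  have hg : Measurable fun p : A × B => s.indicator 1 p.1 * f p :=
    ((measurable_one.indicator hs).comp measurable_fst).mul hf
  have e1 : ∀ ω, (X ⁻¹' s).indicator (fun ω => f (X ω, Y ω)) ω
      = s.indicator 1 (X ω) * f (X ω, Y ω) := fun ω => by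
    by_cases hω : X ω ∈ s <;> simp [Set.indicator, hω]
  have e2 : ∀ ω, (X ⁻¹' s).indicator ((fun x => ∫⁻ y, f (x, y) ∂(P.map Y)) ∘ X) ω
      = s.indicator 1 (X ω) * ∫⁻ y, f (X ω, y) ∂(P.map Y) := fun ω => by
    by_cases hω : X ω ∈ s <;> simp [Set.indicator, hω]
  rw [← lintegral_indicator (hX hs), ← lintegral_indicator (hX hs)]
  rw [lintegral_congr e1, lintegral_congr e2]
  rw [← lintegral_map (f := fun p : A × B => s.indicator 1 p.1 * f p) (g := fun ω => (X ω, Y ω))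
    hg (by fun_prop), (indepFun_iff_map_prod_eq_prod_map_map (by fun_prop) (by fun_prop)).1 h,
    lintegral_prod _ hg.aemeasurable,
    ← lintegral_map (f := fun x => s.indicator 1 x * ∫⁻ y, f (x, y) ∂(P.map Y))
      ((measurable_one.indicator hs).mul hm) hX]
  refine lintegral_congr fun x => ?_
  exact (lintegral_const_mul _ (hf.comp measurable_prodMk_left)).symm

end Independence

/-! ### Gradients -/

section Gradients

variable {𝒵 : Type*} {n d : ℕ} {sur : 𝒵 → EuclideanSpace ℝ (Fin d) → ℝ}

lemma hasGradientAt_empRisk (hsur : ∀ z, Differentiable ℝ (sur z)) (s : Fin n → 𝒵)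
    (A : Finset (Fin n)) (w : EuclideanSpace ℝ (Fin d)) :
    HasGradientAt (empRisk sur s A) ((1 / (A.card : ℝ)) • ∑ i ∈ A, ∇ (sur (s i)) w) w := by
  have h : HasFDerivAt (fun w => ∑ i ∈ A, sur (s i) w) (∑ i ∈ A, fderiv ℝ (sur (s i)) w) w :=
    HasFDerivAt.fun_sum fun i _ => (hsur (s i) w).hasFDerivAt
  rw [hasGradientAt_iff_hasFDerivAt]
  have h' : InnerProductSpace.toDual ℝ (EuclideanSpace ℝ (Fin d))
      ((1 / (A.card : ℝ)) • ∑ i ∈ A, ∇ (sur (s i)) w)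
      = (1 / (A.card : ℝ)) • ∑ i ∈ A, fderiv ℝ (sur (s i)) w := by
    rw [map_smul, map_sum]
    simp [gradient]
  rw [h']
  exact h.const_mul (1 / (A.card : ℝ))

lemma gradient_empRisk (hsur : ∀ z, Differentiable ℝ (sur z)) (s : Fin n → 𝒵)
    (A : Finset (Fin n)) (w : EuclideanSpace ℝ (Fin d)) :
    ∇ (empRisk sur s A) w = (1 / (A.card : ℝ)) • ∑ i ∈ A, ∇ (sur (s i)) w :=
  (hasGradientAt_empRisk hsur s A w).gradient

lemma gradient_empRisk_univ (hn : 0 < n) (hsur : ∀ z, Differentiable ℝ (sur z)) (s : Fin n → 𝒵)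
    (j : Fin n) (w : EuclideanSpace ℝ (Fin d)) :
    ∇ (empRisk sur s Finset.univ) w
      = (((n : ℝ) - 1) / n) • ∇ (empRisk sur s (Finset.univ.erase j)) w
        + (1 / (n : ℝ)) • ∇ (sur (s j)) w := by
  rw [gradient_empRisk hsur, gradient_empRisk hsur, Finset.card_univ, Fintype.card_fin,
    Finset.card_erase_of_mem (Finset.mem_univ j), Finset.card_univ, Fintype.card_fin,
    Nat.cast_sub hn, Nat.cast_one, ← Finset.sum_erase_add _ _ (Finset.mem_univ j), smul_add,
    smul_smul]
  congr 1
  -- For `n = 1` the reduced sample is empty and both sides vanish; otherwise the factors `n - 1`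
  -- cancel.
  rcases eq_or_ne ((n : ℝ) - 1) 0 with h | h
  · have : n = 1 := by
      have : (n : ℝ) = 1 := by linarith
      exact_mod_cast this
    subst this
    have : (Finset.univ : Finset (Fin 1)).erase j = ∅ := by
      ext i; simp [Subsingleton.elim i j]
    rw [this]
    simp
  · congr 1
    have : (n : ℝ) ≠ 0 := by positivity
    field_simp

/-- Each partial derivative is a pointwise limit of difference quotients with step `1 / (k + 1)`,
which are jointly measurable; continuity of the gradient plays no role. -/
lemma measurable_gradient [MeasurableSpace 𝒵] (hmeas : Measurable (Function.uncurry sur))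
    (hsur : ∀ z, Differentiable ℝ (sur z)) :
    Measurable fun p : 𝒵 × EuclideanSpace ℝ (Fin d) => ∇ (sur p.1) p.2 := by
  have key : ∀ i : Fin d, Measurable fun p : 𝒵 × EuclideanSpace ℝ (Fin d) =>
      (∇ (sur p.1) p.2) i := fun i => by
    set v : EuclideanSpace ℝ (Fin d) := EuclideanSpace.single i 1
    have h1 : ∀ p : 𝒵 × EuclideanSpace ℝ (Fin d),
        (∇ (sur p.1) p.2) i = fderiv ℝ (sur p.1) p.2 v := fun p => by
      have : fderiv ℝ (sur p.1) p.2 v = inner ℝ (∇ (sur p.1) p.2) v :=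
        (hsur p.1 p.2).hasGradientAt.fderiv_apply
      rw [this, EuclideanSpace.inner_single_right]
      simp
    simp_rw [h1]
    refine measurable_of_tendsto_metrizable (f := fun (k : ℕ) p =>
      ((k : ℝ) + 1) • (sur p.1 (p.2 + ((k : ℝ) + 1)⁻¹ • v) - sur p.1 p.2)) (fun k => ?_) ?_
    · have h2 : Measurable fun p : 𝒵 × EuclideanSpace ℝ (Fin d) =>
          sur p.1 (p.2 + ((k : ℝ) + 1)⁻¹ • v) :=
        hmeas.comp (measurable_fst.prodMk (measurable_snd.add_const _))
      exact (h2.sub hmeas).const_smul ((k : ℝ) + 1)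
    · rw [tendsto_pi_nhds]
      intro p
      exact ((hsur p.1 p.2).hasFDerivAt.lim_real v).comp
        (Filter.tendsto_atTop_add_const_right _ 1 tendsto_natCast_atTop_atTop)
  have := measurable_pi_lambda _ key
  exact (WithLp.measurable_toLp 2 _).comp this

end Gradients

/-! ### Langevin dynamics as a Gaussian chain -/

section Dynamics

variable {𝒵 : Type*} {n d : ℕ}

/-- The summand of the statistic `Y_{·,k}` that belongs to a transition from `w` to `w'`. The maps
`q` and `g k` are the gradients of the risk on the reduced training set and of the loss at the
`k`-th candidate for the removed point. -/
def statIncr (η β : ℕ → ℝ) (n : ℕ) (q : EuclideanSpace ℝ (Fin d) → EuclideanSpace ℝ (Fin d))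
    (g : Fin 2 → EuclideanSpace ℝ (Fin d) → EuclideanSpace ℝ (Fin d)) (t : ℕ)
    (w w' : EuclideanSpace ℝ (Fin d)) (k : Fin 2) : ℝ :=
  β t / (4 * η t) * ‖w' - w + (η t * (((n : ℝ) - 1) / n)) • q w + (η t / n) • g k w‖ ^ 2

/-- One step of the reference dynamics, which weighs the two candidate gradients by `θ` and
`1 - θ`, evaluated at the difference of the two statistics. -/
def refStep (η β : ℕ → ℝ) (n : ℕ) (q : EuclideanSpace ℝ (Fin d) → EuclideanSpace ℝ (Fin d))
    (g : Fin 2 → EuclideanSpace ℝ (Fin d) → EuclideanSpace ℝ (Fin d)) (θ : ℝ → ℝ) (t : ℕ)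
    (s : EuclideanSpace ℝ (Fin d) × ℝ) (x : EuclideanSpace ℝ (Fin d)) :
    EuclideanSpace ℝ (Fin d) × ℝ :=
  let w' := s.1 - (η t * (((n : ℝ) - 1) / n)) • q s.1
    - (η t / n) • (θ s.2 • g 0 s.1 + (1 - θ s.2) • g 1 s.1) + √(2 * η t / β t) • x
  (w', s.2 + (statIncr η β n q g t s.1 w' 1 - statIncr η β n q g t s.1 w' 0))

/-- The normalized difference of the drifts of the dynamics trained on candidate `k` and of the
reference dynamics. -/
def driftGap (η β : ℕ → ℝ) (n : ℕ)
    (g : Fin 2 → EuclideanSpace ℝ (Fin d) → EuclideanSpace ℝ (Fin d)) (θ : ℝ → ℝ) (k : Fin 2)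
    (t : ℕ) (s : EuclideanSpace ℝ (Fin d) × ℝ) : EuclideanSpace ℝ (Fin d) :=
  ((√(2 * η t / β t))⁻¹ * (η t / n) * (θ s.2 - if k = 0 then 1 else 0)) • (g 0 s.1 - g 1 s.1)

/-- The state of the reference dynamics after `t` steps. -/
def refState (η β : ℕ → ℝ) (n : ℕ) (q : EuclideanSpace ℝ (Fin d) → EuclideanSpace ℝ (Fin d))
    (g : Fin 2 → EuclideanSpace ℝ (Fin d) → EuclideanSpace ℝ (Fin d)) (θ : ℝ → ℝ)
    (w₀ : EuclideanSpace ℝ (Fin d)) (e : ℕ → EuclideanSpace ℝ (Fin d)) :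
    ℕ → EuclideanSpace ℝ (Fin d) × ℝ
  | 0 => (w₀, 0)
  | t + 1 => refStep η β n q g θ t (refState η β n q g θ w₀ e t) (e t)

/-- The Langevin iterate together with the difference of the two statistics. -/
def ldState (sur : 𝒵 → EuclideanSpace ℝ (Fin d) → ℝ) (η β : ℕ → ℝ) (zt : Fin 2 → Fin n → 𝒵)
    (u : Fin n → Fin 2) (j : Fin n) (w₀ : EuclideanSpace ℝ (Fin d))
    (e : ℕ → EuclideanSpace ℝ (Fin d)) (t : ℕ) : EuclideanSpace ℝ (Fin d) × ℝ :=
  (ldIterate sur η β (trainingSet zt u) w₀ e t,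
    testStat sur η β zt u j (ldIterate sur η β (trainingSet zt u) w₀ e) t 1
      - testStat sur η β zt u j (ldIterate sur η β (trainingSet zt u) w₀ e) t 0)

/-- Source of the constant `1 / (n√2)`: the noise has variance `2η/β` per coordinate and the
gradient weight is `η/n`, so the squared ratio is `βη / (2n²)`. -/
lemma norm_driftGap_sq {η β : ℕ → ℝ} {t : ℕ} (hη : 0 < η t) (hβ : 0 < β t) (n : ℕ)
    (g : Fin 2 → EuclideanSpace ℝ (Fin d) → EuclideanSpace ℝ (Fin d)) (θ : ℝ → ℝ) (k : Fin 2)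
    (s : EuclideanSpace ℝ (Fin d) × ℝ) :
    ‖driftGap η β n g θ k t s‖ ^ 2 = (1 / (n * √2)) ^ 2 *
      (β t * η t * ‖g 0 s.1 - g 1 s.1‖ ^ 2 * ((if k = 0 then 1 else 0) - θ s.2) ^ 2) := by
  rw [driftGap, norm_smul, mul_pow, Real.norm_eq_abs, sq_abs, mul_pow, mul_pow, inv_pow,
    Real.sq_sqrt (by positivity), div_pow 1, mul_pow (n : ℝ), Real.sq_sqrt (by norm_num)]
  have h : (η t / (n : ℝ)) ^ 2 = η t ^ 2 * ((n : ℝ) ^ 2)⁻¹ := by rw [div_pow, div_eq_mul_inv]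
  have h' : (1 : ℝ) ^ 2 / ((n : ℝ) ^ 2 * 2) = ((n : ℝ) ^ 2)⁻¹ / 2 := by
    rw [one_pow, one_div, mul_inv, div_eq_mul_inv]
  rw [h, h']
  field_simp
  ring

variable {sur : 𝒵 → EuclideanSpace ℝ (Fin d) → ℝ} {η β : ℕ → ℝ}

lemma testStat_succ (zt : Fin 2 → Fin n → 𝒵) (u : Fin n → Fin 2) (j : Fin n)
    (w : ℕ → EuclideanSpace ℝ (Fin d)) (t : ℕ) (k : Fin 2) :
    testStat sur η β zt u j w (t + 1) k = testStat sur η β zt u j w t k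
      + statIncr η β n (∇ (empRisk sur (trainingSet zt u) (Finset.univ.erase j)))
          (fun k => ∇ (sur (zt k j))) t (w t) (w (t + 1)) k := by
  rw [testStat, Finset.sum_Icc_succ_top (by omega)]
  rfl

/-- The Markov property of the augmented state. It holds at every `t`, without positivity of `η t`
and `β t`, as the independence argument requires. -/
lemma ldState_succ (zt : Fin 2 → Fin n → 𝒵) (u : Fin n → Fin 2) (j : Fin n)
    (w₀ : EuclideanSpace ℝ (Fin d)) (e : ℕ → EuclideanSpace ℝ (Fin d)) (t : ℕ) :
    ldState sur η β zt u j w₀ e (t + 1) =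
      (fun (s : EuclideanSpace ℝ (Fin d) × ℝ) (w' : EuclideanSpace ℝ (Fin d)) =>
        (w', s.2
          + (statIncr η β n (∇ (empRisk sur (trainingSet zt u) (Finset.univ.erase j)))
              (fun k => ∇ (sur (zt k j))) t s.1 w' 1
            - statIncr η β n (∇ (empRisk sur (trainingSet zt u) (Finset.univ.erase j)))
              (fun k => ∇ (sur (zt k j))) t s.1 w' 0))) (ldState sur η β zt u j w₀ e t)
        ((ldState sur η β zt u j w₀ e t).1
          - η t • ∇ (empRisk sur (trainingSet zt u) Finset.univ) (ldState sur η β zt u j w₀ e t).1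
          + √(2 * η t / β t) • e t) := by
  simp only [ldState, testStat_succ, ldIterate]
  refine Prod.ext rfl ?_
  simp only
  ring

/-- The mixture minus the gradient at candidate `k` is `θ - 1_{k = 0}` times the difference of the
two gradients. Divided by the noise scale, this discrepancy becomes a translation of the noise. -/
lemma ldState_succ_eq_refStep (hn : 0 < n) (hsur : ∀ z, Differentiable ℝ (sur z)) {t : ℕ}
    (hη : 0 < η t) (hβ : 0 < β t) (θ : ℝ → ℝ) (zt : Fin 2 → Fin n → 𝒵) (u : Fin n → Fin 2)
    (j : Fin n) (w₀ : EuclideanSpace ℝ (Fin d)) (e : ℕ → EuclideanSpace ℝ (Fin d)) :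
    ldState sur η β zt u j w₀ e (t + 1) =
      refStep η β n (∇ (empRisk sur (trainingSet zt u) (Finset.univ.erase j)))
        (fun k => ∇ (sur (zt k j))) θ t (ldState sur η β zt u j w₀ e t)
        (e t + driftGap η β n (fun k => ∇ (sur (zt k j))) θ (u j) t
          (ldState sur η β zt u j w₀ e t)) := by
  rw [ldState_succ, refStep]
  set s := ldState sur η β zt u j w₀ e t
  have hσ : √(2 * η t / β t) ≠ 0 := (Real.sqrt_pos.2 (by positivity)).ne'
  have hw : s.1 - η t • ∇ (empRisk sur (trainingSet zt u) Finset.univ) s.1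
        + √(2 * η t / β t) • e t
      = s.1 - (η t * (((n : ℝ) - 1) / n)) •
            ∇ (empRisk sur (trainingSet zt u) (Finset.univ.erase j)) s.1
          - (η t / n) • (θ s.2 • ∇ (sur (zt 0 j)) s.1 + (1 - θ s.2) • ∇ (sur (zt 1 j)) s.1)
          + √(2 * η t / β t) •
            (e t + driftGap η β n (fun k => ∇ (sur (zt k j))) θ (u j) t s) := by
    rw [gradient_empRisk_univ hn hsur _ j, driftGap, smul_add (√(2 * η t / β t)), smul_smul,
      ← mul_assoc, ← mul_assoc, mul_inv_cancel₀ hσ, one_mul]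
    simp only [trainingSet]
    rcases Fin.exists_fin_two.1 ⟨u j, rfl⟩ with h | h
    · rw [h]
      simp only [if_true]
      module
    · rw [h]
      simp only [one_ne_zero, if_false]
      module
  simp only [hw]

lemma empRisk_congr {f : 𝒵 → EuclideanSpace ℝ (Fin d) → ℝ} {s s' : Fin n → 𝒵}
    {A : Finset (Fin n)} (h : ∀ i ∈ A, s i = s' i) : empRisk f s A = empRisk f s' A := by
  funext w
  rw [empRisk, empRisk, Finset.sum_congr rfl fun i hi => by rw [h i hi]]

/-! ### Measurability in the data, the initial point and the noise -/

section Measurability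

variable [MeasurableSpace 𝒵]

lemma measurable_gradient_apply (hmeas : Measurable (Function.uncurry sur))
    (hsur : ∀ z, Differentiable ℝ (sur z)) (z : 𝒵) : Measurable (∇ (sur z)) :=
  (measurable_gradient hmeas hsur).comp measurable_prodMk_left

lemma measurable_gradient_empRisk (hmeas : Measurable (Function.uncurry sur))
    (hsur : ∀ z, Differentiable ℝ (sur z)) (A : Finset (Fin n)) :
    Measurable fun p : (Fin n → 𝒵) × EuclideanSpace ℝ (Fin d) => ∇ (empRisk sur p.1 A) p.2 := by
  simp_rw [gradient_empRisk hsur]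
  have h : Measurable fun p : (Fin n → 𝒵) × EuclideanSpace ℝ (Fin d) =>
      ∑ i ∈ A, ∇ (sur (p.1 i)) p.2 := Finset.measurable_fun_sum _ fun i _ => by
    have hi : Measurable fun p : (Fin n → 𝒵) × EuclideanSpace ℝ (Fin d) => (p.1 i, p.2) :=
      ((measurable_pi_apply i).comp measurable_fst).prodMk measurable_snd
    exact (measurable_gradient hmeas hsur).comp hi
  exact h.const_smul (1 / (A.card : ℝ))

lemma measurable_gradient_empRisk_apply (hmeas : Measurable (Function.uncurry sur))
    (hsur : ∀ z, Differentiable ℝ (sur z)) (s : Fin n → 𝒵) (A : Finset (Fin n)) :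
    Measurable (∇ (empRisk sur s A)) := by
  rw [funext (gradient_empRisk hsur s A)]
  have h : Measurable fun w => ∑ i ∈ A, ∇ (sur (s i)) w :=
    Finset.measurable_fun_sum _ fun i _ => measurable_gradient_apply hmeas hsur _
  exact h.const_smul (1 / (A.card : ℝ))

lemma measurable_trainingSet (u : Fin n → Fin 2) :
    Measurable fun zt : Fin 2 → Fin n → 𝒵 => trainingSet zt u :=
  measurable_pi_lambda _ fun i =>
    (measurable_pi_apply (X := fun _ : Fin n => 𝒵) i).comp (measurable_pi_apply (u i))

lemma measurable_ldIterate (hmeas : Measurable (Function.uncurry sur))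
    (hsur : ∀ z, Differentiable ℝ (sur z)) (η β : ℕ → ℝ) (t : ℕ) :
    Measurable fun p : (Fin n → 𝒵) × EuclideanSpace ℝ (Fin d) × (ℕ → EuclideanSpace ℝ (Fin d)) =>
      ldIterate sur η β p.1 p.2.1 p.2.2 t := by
  induction t with
  | zero => exact measurable_fst.comp measurable_snd
  | succ t ih =>
    have h := (measurable_gradient_empRisk hmeas hsur Finset.univ).comp
      (measurable_fst.prodMk ih)
    have he : Measurable fun p : (Fin n → 𝒵) × EuclideanSpace ℝ (Fin d) ×
        (ℕ → EuclideanSpace ℝ (Fin d)) => p.2.2 t :=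
      (measurable_pi_apply t).comp (measurable_snd.comp measurable_snd)
    exact (ih.sub (h.const_smul (η t))).add (he.const_smul (√(2 * η t / β t)))

lemma measurable_statIncr {q : EuclideanSpace ℝ (Fin d) → EuclideanSpace ℝ (Fin d)}
    {g : Fin 2 → EuclideanSpace ℝ (Fin d) → EuclideanSpace ℝ (Fin d)} (hq : Measurable q)
    (hg : ∀ k, Measurable (g k)) (t : ℕ) (k : Fin 2) :
    Measurable fun p : EuclideanSpace ℝ (Fin d) × EuclideanSpace ℝ (Fin d) =>
      statIncr η β n q g t p.1 p.2 k := by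
  have := hg k
  unfold statIncr
  fun_prop

lemma measurable_refStep {q : EuclideanSpace ℝ (Fin d) → EuclideanSpace ℝ (Fin d)}
    {g : Fin 2 → EuclideanSpace ℝ (Fin d) → EuclideanSpace ℝ (Fin d)} (hq : Measurable q)
    (hg : ∀ k, Measurable (g k)) {θ : ℝ → ℝ} (hθ : Measurable θ) (t : ℕ) :
    Measurable (Function.uncurry (refStep η β n q g θ t)) := by
  have h0 := hg 0
  have h1 := hg 1
  have hw : Measurable fun p : (EuclideanSpace ℝ (Fin d) × ℝ) × EuclideanSpace ℝ (Fin d) =>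
      p.1.1 - (η t * (((n : ℝ) - 1) / n)) • q p.1.1
        - (η t / n) • (θ p.1.2 • g 0 p.1.1 + (1 - θ p.1.2) • g 1 p.1.1)
        + √(2 * η t / β t) • p.2 := by fun_prop
  have hs := fun k => (measurable_statIncr (η := η) (β := β) (n := n) hq hg t k).comp
    ((measurable_fst.comp measurable_fst).prodMk hw)
  exact hw.prodMk ((measurable_snd.comp measurable_fst).add ((hs 1).sub (hs 0)))

lemma measurable_testStat (hmeas : Measurable (Function.uncurry sur))
    (hsur : ∀ z, Differentiable ℝ (sur z)) (η β : ℕ → ℝ) (u : Fin n → Fin 2) (j : Fin n) (t : ℕ)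
    (k : Fin 2) :
    Measurable fun p : (Fin 2 → Fin n → 𝒵) × (ℕ → EuclideanSpace ℝ (Fin d)) =>
      testStat sur η β p.1 u j p.2 t k := by
  unfold testStat
  refine Finset.measurable_fun_sum _ fun i _ => ?_
  have hw : ∀ i, Measurable fun p : (Fin 2 → Fin n → 𝒵) × (ℕ → EuclideanSpace ℝ (Fin d)) =>
      p.2 i := fun i => (measurable_pi_apply i).comp measurable_snd
  have hs : Measurable fun p : (Fin 2 → Fin n → 𝒵) × (ℕ → EuclideanSpace ℝ (Fin d)) =>
      (trainingSet p.1 u, p.2 (i - 1)) :=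
    ((measurable_trainingSet u).comp measurable_fst).prodMk (hw (i - 1))
  have hz : Measurable fun p : (Fin 2 → Fin n → 𝒵) × (ℕ → EuclideanSpace ℝ (Fin d)) =>
      (p.1 k j, p.2 (i - 1)) :=
    ((measurable_pi_apply j).comp ((measurable_pi_apply k).comp measurable_fst)).prodMk
      (hw (i - 1))
  have hq : Measurable fun p : (Fin 2 → Fin n → 𝒵) × (ℕ → EuclideanSpace ℝ (Fin d)) =>
      ∇ (empRisk sur (trainingSet p.1 u) (Finset.univ.erase j)) (p.2 (i - 1)) := by
    have h := (measurable_gradient_empRisk hmeas hsur (Finset.univ.erase j)).comp hs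
    simpa only [Function.comp_def] using h
  have hg : Measurable fun p : (Fin 2 → Fin n → 𝒵) × (ℕ → EuclideanSpace ℝ (Fin d)) =>
      ∇ (sur (p.1 k j)) (p.2 (i - 1)) := by
    have h := (measurable_gradient hmeas hsur).comp hz
    simpa only [Function.comp_def] using h
  have hwi := hw i
  have hwi' := hw (i - 1)
  fun_prop

end Measurability

/-! ### Distance between the Langevin and the reference dynamics -/

section Comparison

variable [MeasurableSpace 𝒵] {Ω : Type*} [MeasurableSpace Ω] {P : Measure Ω}
  [IsProbabilityMeasure P] {W₀ : Ω → EuclideanSpace ℝ (Fin d)}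
  {ε : ℕ → Ω → EuclideanSpace ℝ (Fin d)}

/-- The expected value of a bounded function of the last Langevin iterate and of the last state
of the reference dynamics are close. -/
lemma ofReal_integral_ldIterate_sub_le (hn : 0 < n) (hmeas : Measurable (Function.uncurry sur))
    (hsur : ∀ z, Differentiable ℝ (sur z)) {T : ℕ} (hη : ∀ t < T, 0 < η t) (hβ : ∀ t < T, 0 < β t)
    (hW₀ : Measurable W₀) (hε : ∀ t, Measurable (ε t))
    (hlaw : ∀ t, P.map (ε t) = stdGaussian (EuclideanSpace ℝ (Fin d))) (hind : iIndepFun ε P)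
    (hind₀ : IndepFun W₀ (fun ω t => ε t ω) P) {θ : ℝ → ℝ} (hθ : Measurable θ)
    (zt : Fin 2 → Fin n → 𝒵) (u : Fin n → Fin 2) (j : Fin n)
    {f : EuclideanSpace ℝ (Fin d) → ℝ} (hf : Measurable f) (hf1 : ∀ w, |f w| ≤ 1) :
    ENNReal.ofReal
        (∫ ω, f (ldIterate sur η β (trainingSet zt u) (W₀ ω) (fun t => ε t ω) T) ∂P
          - ∫ ω, f (refState η β n
              (∇ (empRisk sur (trainingSet zt u) (Finset.univ.erase j)))
              (fun k => ∇ (sur (zt k j))) θ (W₀ ω) (fun t => ε t ω) T).1 ∂P)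
      ≤ ENNReal.ofReal (1 / (n * √2)) *
        (∑ t ∈ Finset.range T, ∫⁻ ω, ENNReal.ofReal (β t * η t *
          ‖incoherence sur zt j
            (ldIterate sur η β (trainingSet zt u) (W₀ ω) (fun t => ε t ω) t)‖ ^ 2 *
          ((if u j = 0 then 1 else 0)
            - θ (ldState sur η β zt u j (W₀ ω) (fun t => ε t ω) t).2) ^ 2) ∂P) ^ (1 / 2 : ℝ) := by
  set q := ∇ (empRisk sur (trainingSet zt u) (Finset.univ.erase j))
  set g : Fin 2 → EuclideanSpace ℝ (Fin d) → EuclideanSpace ℝ (Fin d) :=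
    fun k => ∇ (sur (zt k j))
  have hq : Measurable q := measurable_gradient_empRisk_apply hmeas hsur _ _
  have hg : ∀ k, Measurable (g k) := fun k => measurable_gradient_apply hmeas hsur _
  have hfull : Measurable (∇ (empRisk sur (trainingSet zt u) Finset.univ)) :=
    measurable_gradient_empRisk_apply hmeas hsur _ _
  have hφ : Measurable fun w : EuclideanSpace ℝ (Fin d) => (w, (0 : ℝ)) := by fun_prop
  set X : ℕ → Ω → EuclideanSpace ℝ (Fin d) × ℝ :=
    fun t ω => ldState sur η β zt u j (W₀ ω) (fun t => ε t ω) t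
  set X' : ℕ → Ω → EuclideanSpace ℝ (Fin d) × ℝ :=
    fun t ω => refState η β n q g θ (W₀ ω) (fun t => ε t ω) t
  have hG := fun t => measurable_refStep (η := η) (β := β) (n := n) hq hg hθ t
  have hX0 : ∀ ω, X 0 ω = (W₀ ω, 0) := fun ω => by simp [X, ldState, ldIterate, testStat]
  have hHm : ∀ t, Measurable fun p : (EuclideanSpace ℝ (Fin d) × ℝ) × EuclideanSpace ℝ (Fin d) =>
      p.1.1 - η t • ∇ (empRisk sur (trainingSet zt u) Finset.univ) p.1.1
        + √(2 * η t / β t) • p.2 := fun t => by fun_prop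
  -- Independence comes from the plain Langevin recursion, valid for all `t`; the form through
  -- `refStep` is available only for `t < T`.
  have hXi := indepFun_of_recursion hW₀ hε hind hind₀ (X := X)
    (H := fun t s x => (fun (s : EuclideanSpace ℝ (Fin d) × ℝ) (w' : EuclideanSpace ℝ (Fin d)) =>
        (w', s.2 + (statIncr η β n q g t s.1 w' 1 - statIncr η β n q g t s.1 w' 0))) s
        (s.1 - η t • ∇ (empRisk sur (trainingSet zt u) Finset.univ) s.1
          + √(2 * η t / β t) • x))
    (fun t => by
      have hs := fun k => (measurable_statIncr (η := η) (β := β) (n := n) hq hg t k).comp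
        ((measurable_fst.comp measurable_fst).prodMk (hHm t))
      exact (hHm t).prodMk ((measurable_snd.comp measurable_fst).add ((hs 1).sub (hs 0))))
    hφ hX0 fun t ω => ldState_succ zt u j (W₀ ω) (fun t => ε t ω) t
  have hXi' := indepFun_of_recursion hW₀ hε hind hind₀ (X := X') hG hφ (fun ω => rfl)
    fun t ω => rfl
  have hc : IsGaussianChain P ε (refStep η β n q g θ) (driftGap η β n g θ (u j)) X T :=
    { measurable_chain := fun t => (hXi t).1
      measurable_noise := hε
      law_noise := hlaw
      indep := fun t => (hXi t).2
      measurable_step := hG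
      measurable_drift := fun t => by
        have h0 := hg 0
        have h1 := hg 1
        unfold driftGap
        fun_prop
      step := fun t ht ω => ldState_succ_eq_refStep hn hsur (hη t ht) (hβ t ht) θ zt u j _ _ }
  have hc' : IsGaussianChain P ε (refStep η β n q g θ) (fun _ _ => 0) X' T :=
    { measurable_chain := fun t => (hXi' t).1
      measurable_noise := hε
      law_noise := hlaw
      indep := fun t => (hXi' t).2
      measurable_step := hG
      measurable_drift := fun t => measurable_const
      step := fun t _ ω => by rw [add_zero]; rfl }
  have hmain := hc.ofReal_integral_sub_le hc' (funext hX0) (f := fun s => f s.1)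
    (hf.comp measurable_fst) fun s => hf1 s.1
  refine hmain.trans (le_of_eq ?_)
  have hC : 0 ≤ 1 / (n * √2) := by positivity
  -- The constant is written as a square root so that it can be moved under the root and matched
  -- with `norm_driftGap_sq` term by term.
  have hsq : ENNReal.ofReal (1 / (n * √2))
      = (ENNReal.ofReal ((1 / (n * √2)) ^ 2)) ^ (1 / 2 : ℝ) := by
    rw [ENNReal.ofReal_rpow_of_nonneg (sq_nonneg _) (by norm_num), ← Real.sqrt_eq_rpow,
      Real.sqrt_sq hC]
  rw [hsq, ← ENNReal.mul_rpow_of_nonneg _ _ (by norm_num), Finset.mul_sum]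
  congr 1
  refine Finset.sum_congr rfl fun t ht => ?_
  rw [← lintegral_const_mul' _ _ ENNReal.ofReal_ne_top]
  refine lintegral_congr fun ω => ?_
  rw [norm_driftGap_sq (hη t (Finset.mem_range.1 ht)) (hβ t (Finset.mem_range.1 ht)),
    ENNReal.ofReal_mul (sq_nonneg _)]
  rfl

end Comparison

end Dynamics

/-! ### Resampling and symmetrization -/

section Resampling

lemma map_update_pi {ι A : Type*} [Fintype ι] [DecidableEq ι] [MeasurableSpace A] (μ : Measure A)
    [IsProbabilityMeasure μ] (i : ι) :
    ((Measure.pi fun _ : ι => μ).prod μ).map (fun p => Function.update p.1 i p.2)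
      = Measure.pi fun _ : ι => μ := by
  have hm : Measurable fun p : (ι → A) × A => Function.update p.1 i p.2 := measurable_update'
  refine (Measure.pi_eq fun s hs => ?_).symm
  rw [Measure.map_apply hm (MeasurableSet.univ_pi hs)]
  have : (fun p : (ι → A) × A => Function.update p.1 i p.2) ⁻¹' Set.univ.pi s
      = (Set.univ.pi (Function.update s i Set.univ)) ×ˢ s i := by
    ext p
    simp only [Set.mem_preimage, Set.mem_pi, Set.mem_univ, forall_const, Set.mem_prod]
    constructor
    · intro h
      refine ⟨fun k => ?_, by simpa using h i⟩
      rcases eq_or_ne k i with rfl | hk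
      · simp
      · simpa [hk] using h k
    · rintro ⟨h, h'⟩ k
      rcases eq_or_ne k i with rfl | hk
      · simpa using h'
      · simpa [hk] using h k
  rw [this, Measure.prod_prod, Measure.pi_pi, ← Finset.prod_erase_mul _ _ (Finset.mem_univ i),
    ← Finset.prod_erase_mul (Finset.univ) (fun k => μ (s k)) (Finset.mem_univ i)]
  simp only [Function.update_self, measure_univ, mul_one]
  congr 1
  refine Finset.prod_congr rfl fun k hk => ?_
  rw [Function.update_of_ne (Finset.ne_of_mem_erase hk)]

/-- Redrawing a single entry of an i.i.d. array does not change its law: `map_update_pi` is applied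
to the row inside the array and to the entry inside the row. -/
lemma measurePreserving_update_update {ι κ A : Type*} [Fintype ι] [DecidableEq ι] [Fintype κ]
    [DecidableEq κ]
    [MeasurableSpace A] (μ : Measure A) [IsProbabilityMeasure μ] (a : ι) (j : κ) :
    MeasurePreserving
      (fun p : (ι → κ → A) × A => Function.update p.1 a (Function.update (p.1 a) j p.2))
      ((Measure.pi fun _ : ι => Measure.pi fun _ : κ => μ).prod μ)
      (Measure.pi fun _ : ι => Measure.pi fun _ : κ => μ) := by
  set ρ : Measure (κ → A) := Measure.pi fun _ : κ => μ
  set π : Measure (ι → κ → A) := Measure.pi fun _ : ι => ρ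
  have h1 : MeasurePreserving (fun p : (ι → κ → A) × (κ → A) => Function.update p.1 a p.2)
      (π.prod ρ) π := ⟨measurable_update', map_update_pi ρ a⟩
  have h2 : MeasurePreserving (fun p : (κ → A) × A => Function.update p.1 j p.2)
      (ρ.prod μ) ρ := ⟨measurable_update', map_update_pi μ j⟩
  have h3 := h1.comp (((MeasurePreserving.id π).prod h2).comp (measurePreserving_prodAssoc π ρ μ))
  have h4 := h1.prod (MeasurePreserving.id μ)
  have hm : Measurable fun p : (ι → κ → A) × A =>
      Function.update p.1 a (Function.update (p.1 a) j p.2) := by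
    have h5 : Measurable fun p : (ι → κ → A) × A => Function.update (p.1 a) j p.2 :=
      h2.measurable.comp (g := fun p : (κ → A) × A => Function.update p.1 j p.2)
        (f := fun p : (ι → κ → A) × A => (p.1 a, p.2))
        (((measurable_pi_apply a).comp measurable_fst).prodMk measurable_snd)
    exact (measurable_update' (a := a)).comp (measurable_fst.prodMk h5)
  refine ⟨hm, ?_⟩
  rw [← h4.map_eq, Measure.map_map hm h4.measurable]
  refine Eq.trans ?_ h3.map_eq
  congr 1
  funext p
  simp [Function.comp_def, MeasurableEquiv.prodAssoc]

lemma measurePreserving_uniformOn_univ {A : Type*} [Fintype A] [MeasurableSpace A]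
    [MeasurableSingletonClass A] (e : A ≃ A) :
    MeasurePreserving e (uniformOn (Set.univ : Set A)) (uniformOn Set.univ) := by
  refine ⟨measurable_of_finite _, Measure.ext fun s hs => ?_⟩
  rw [Measure.map_apply (measurable_of_finite _) hs, uniformOn_univ, uniformOn_univ,
    Measure.count_apply (measurable_of_finite e hs), Measure.count_apply hs]
  congr 2
  exact Set.encard_preimage_of_bijective e.bijective s

lemma integral_uniformOn_univ {A : Type*} [Fintype A] [MeasurableSpace A]
    [MeasurableSingletonClass A] [Nonempty A] (f : A → ℝ) :
    ∫ a, f a ∂(uniformOn (Set.univ : Set A)) = (1 / (Fintype.card A : ℝ)) * ∑ a, f a := by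
  rw [integral_fintype (Integrable.of_finite), Finset.mul_sum]
  refine Finset.sum_congr rfl fun a _ => ?_
  rw [measureReal_def, uniformOn_univ, Measure.count_singleton]
  simp

lemma ofReal_integral_le_lintegral_ofReal {A : Type*} [MeasurableSpace A] {μ : Measure A}
    {f : A → ℝ} (hf : Integrable f μ) :
    ENNReal.ofReal (∫ a, f a ∂μ) ≤ ∫⁻ a, ENNReal.ofReal (f a) ∂μ := by
  have h : ∀ a, ENNReal.ofReal (f a) = ENNReal.ofReal (max (f a) 0) := fun a => by
    rcases le_total (f a) 0 with h | h <;> simp [h, ENNReal.ofReal_of_nonpos]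
  rw [lintegral_congr h, ← ofReal_integral_eq_lintegral_ofReal hf.pos_part
    (Filter.Eventually.of_forall fun _ => le_max_right _ _)]
  exact ENNReal.ofReal_le_ofReal (integral_mono hf hf.pos_part fun _ => le_max_left _ _)

/-- Integrating the hypothesis over the invariant measure doubles both sides. A bound on orbit sums
is thus enough, although `f` itself need not be bounded by `r` pointwise. -/
lemma ofReal_integral_le_of_symm {A : Type*} [MeasurableSpace A] {μ : Measure A} {φ : A → A}
    (hφ : MeasurePreserving φ μ μ) {f : A → ℝ} (hf : Integrable f μ)
    {r : A → ℝ≥0∞} (hr : Measurable r)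
    (h : ∀ a, ENNReal.ofReal (f a + f (φ a)) ≤ r a + r (φ a)) :
    ENNReal.ofReal (∫ a, f a ∂μ) ≤ ∫⁻ a, r a ∂μ := by
  have hfφ : Integrable (fun a => f (φ a)) μ := hφ.integrable_comp_of_integrable hf
  have h1 : ∫ a, f (φ a) ∂μ = ∫ a, f a ∂μ := by
    conv_rhs => rw [← hφ.map_eq]
    rw [integral_map hφ.measurable.aemeasurable (by rw [hφ.map_eq]; exact hf.1)]
  have h2 : ENNReal.ofReal (∫ a, f a + f (φ a) ∂μ) ≤ ∫⁻ a, r a + r (φ a) ∂μ :=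
    (ofReal_integral_le_lintegral_ofReal (hf.add hfφ)).trans (lintegral_mono h)
  rw [integral_add hf hfφ, h1, lintegral_add_left hr, hφ.lintegral_comp hr, ← two_mul, ← two_mul,
    ENNReal.ofReal_mul zero_le_two, ENNReal.ofReal_ofNat] at h2
  exact (ENNReal.mul_le_mul_iff_right two_ne_zero ENNReal.ofNat_ne_top).1 h2

variable {𝒵 : Type*} [MeasurableSpace 𝒵] {n d : ℕ}

/-- The selection `u` with its `j`-th index replaced by the other row. -/
def flipAt (j : Fin n) (u : Fin n → Fin 2) : Fin n → Fin 2 :=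
  Function.update u j (1 - u j)

lemma flipAt_flipAt (j : Fin n) (u : Fin n → Fin 2) : flipAt j (flipAt j u) = u := by
  have h : ∀ k : Fin 2, 1 - (1 - k) = k := by decide
  simp [flipAt, h]

/-- For each fixed `j` the flip is an involution of the finite set of selections, hence preserves
the uniform law. The coordinates are swapped to present the map as a skew product over `j`. -/
lemma measurePreserving_flipAt {A : Type*} [MeasurableSpace A] (μ : Measure A)
    [SFinite μ] (ν : Measure (Fin n)) [SFinite ν] :
    MeasurePreserving (fun a : A × (Fin n → Fin 2) × Fin n => (a.1, flipAt a.2.2 a.2.1, a.2.2))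
      (μ.prod ((uniformOn Set.univ).prod ν)) (μ.prod ((uniformOn Set.univ).prod ν)) := by
  have h : MeasurePreserving (fun p : Fin n × (Fin n → Fin 2) => (p.1, flipAt p.1 p.2))
      (ν.prod (uniformOn Set.univ)) (ν.prod (uniformOn Set.univ)) :=
    (MeasurePreserving.id ν).skew_product (g := flipAt) (measurable_of_finite _)
      (Filter.Eventually.of_forall fun j =>
        (measurePreserving_uniformOn_univ
          (Function.Involutive.toPerm (flipAt j) (flipAt_flipAt j))).map_eq)
  have h' := Measure.measurePreserving_swap.comp (h.comp
    (Measure.measurePreserving_swap (μ := uniformOn (Set.univ : Set (Fin n → Fin 2))) (ν := ν)))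
  exact (MeasurePreserving.id μ).prod h'

/-- Reduces measurability to fixed selection and column, since entries such as `zt (u j) j` are then
plain coordinate projections. -/
lemma measurable_of_forall_index {A K B C : Type*} [MeasurableSpace A] [MeasurableSpace B]
    [MeasurableSpace C] [MeasurableSpace K] [Countable K] [MeasurableSingletonClass K]
    {f : (A × K) × B → C} (hf : ∀ k, Measurable fun p : A × B => f ((p.1, k), p.2)) :
    Measurable f := by
  have h : Measurable fun p : K × A × B => f ((p.2.1, p.1), p.2.2) :=
    measurable_from_prod_countable_right hf
  exact h.comp (g := fun p : K × A × B => f ((p.2.1, p.1), p.2.2))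
    (f := fun p : (A × K) × B => (p.1.2, p.1.1, p.2)) (by fun_prop)

lemma integrable_of_mem_Icc_zero_one {A : Type*} [MeasurableSpace A] {μ : Measure A}
    [IsProbabilityMeasure μ] {f : A → ℝ} (hf : Measurable f)
    (hb : ∀ a, f a ∈ Set.Icc (0 : ℝ) 1) : Integrable f μ :=
  Integrable.of_mem_Icc 0 1 hf.aemeasurable (Filter.Eventually.of_forall hb)

lemma integral_mem_Icc_zero_one {A : Type*} [MeasurableSpace A] {μ : Measure A}
    [IsProbabilityMeasure μ] {f : A → ℝ} (hf : Measurable f)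
    (hb : ∀ a, f a ∈ Set.Icc (0 : ℝ) 1) : ∫ a, f a ∂μ ∈ Set.Icc (0 : ℝ) 1 := by
  refine ⟨integral_nonneg fun a => (hb a).1, ?_⟩
  simpa using integral_mono (integrable_of_mem_Icc_zero_one (μ := μ) hf hb)
    (integrable_const 1) fun a => (hb a).2

lemma measurable_integral_prodMk {A B : Type*} [MeasurableSpace A] [MeasurableSpace B]
    (μ : Measure B) [SFinite μ] {f : A × B → ℝ} (hf : Measurable f) :
    Measurable fun a => ∫ b, f (a, b) ∂μ :=
  (StronglyMeasurable.integral_prod_right' hf.stronglyMeasurable).measurable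

/-- The expected generalization gap of an algorithm `w` trained on a selection from a super-sample
equals the expected difference of its losses at the unselected and at the selected entry of a
uniform column. -/
lemma integral_risk_sub_empRisk {Ω : Type*} [MeasurableSpace Ω] (P : Measure Ω)
    [IsProbabilityMeasure P] (D : Measure 𝒵) [IsProbabilityMeasure D] (hn : 0 < n)
    {loss : 𝒵 → EuclideanSpace ℝ (Fin d) → ℝ} (hloss_meas : Measurable (Function.uncurry loss))
    (hloss : ∀ z w, loss z w ∈ Set.Icc (0 : ℝ) 1)
    {w : (Fin n → 𝒵) → Ω → EuclideanSpace ℝ (Fin d)} (hw : Measurable (Function.uncurry w))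
    (ν : Measure (Fin n → Fin 2)) [IsProbabilityMeasure ν] :
    ∫ a : (Fin 2 → Fin n → 𝒵) × (Fin n → Fin 2) × Fin n,
        ∫ ω, (risk D loss (w (trainingSet a.1 a.2.1) ω)
          - empRisk loss (trainingSet a.1 a.2.1) Finset.univ (w (trainingSet a.1 a.2.1) ω)) ∂P
        ∂((Measure.pi fun _ => Measure.pi fun _ => D).prod (ν.prod (uniformOn Set.univ)))
      = ∫ a : (Fin 2 → Fin n → 𝒵) × (Fin n → Fin 2) × Fin n,
        ∫ ω, (loss (a.1 (1 - a.2.1 a.2.2) a.2.2) (w (trainingSet a.1 a.2.1) ω)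
          - loss (a.1 (a.2.1 a.2.2) a.2.2) (w (trainingSet a.1 a.2.1) ω)) ∂P
        ∂((Measure.pi fun _ => Measure.pi fun _ => D).prod (ν.prod (uniformOn Set.univ))) := by
  have : Nonempty (Fin n) := ⟨⟨0, hn⟩⟩
  set π : Measure (Fin 2 → Fin n → 𝒵) := Measure.pi fun _ => Measure.pi fun _ => D
  set υ : Measure (Fin n) := uniformOn Set.univ
  set w' : (Fin 2 → Fin n → 𝒵) × (Fin n → Fin 2) × Fin n → Ω → EuclideanSpace ℝ (Fin d) :=
    fun a ω => w (trainingSet a.1 a.2.1) ω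
  have hwm : ∀ k : (Fin n → Fin 2) × Fin n,
      Measurable fun p : (Fin 2 → Fin n → 𝒵) × Ω => w' (p.1, k) p.2 := fun k => by
    have h1 : Measurable fun p : (Fin 2 → Fin n → 𝒵) × Ω => (trainingSet p.1 k.1, p.2) :=
      ((measurable_trainingSet k.1).comp measurable_fst).prodMk measurable_snd
    exact hw.comp h1
  have hlm : ∀ (v : (Fin n → Fin 2) × Fin n → Fin 2),
      Measurable fun p : ((Fin 2 → Fin n → 𝒵) × (Fin n → Fin 2) × Fin n) × Ω =>
        loss (p.1.1 (v p.1.2) p.1.2.2) (w' p.1 p.2) := fun v => by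
    refine measurable_of_forall_index fun k => ?_
    have h1 : Measurable fun p : (Fin 2 → Fin n → 𝒵) × Ω => p.1 (v k) k.2 :=
      (measurable_pi_apply k.2).comp ((measurable_pi_apply (v k)).comp measurable_fst)
    exact hloss_meas.comp (h1.prodMk (hwm k))
  have hriskm : Measurable (risk D loss) := by
    have h1 : Measurable fun p : EuclideanSpace ℝ (Fin d) × 𝒵 => loss p.2 p.1 :=
      hloss_meas.comp measurable_swap
    exact measurable_integral_prodMk D h1
  have hrisk : ∀ x, risk D loss x ∈ Set.Icc (0 : ℝ) 1 := fun x =>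
    integral_mem_Icc_zero_one (hloss_meas.comp measurable_prodMk_right) fun z => hloss z x
  have hRm : Measurable fun p : ((Fin 2 → Fin n → 𝒵) × (Fin n → Fin 2) × Fin n) × Ω =>
      risk D loss (w' p.1 p.2) :=
    measurable_of_forall_index fun k => hriskm.comp (hwm k)
  have hω : ∀ {f : ((Fin 2 → Fin n → 𝒵) × (Fin n → Fin 2) × Fin n) × Ω → ℝ}, Measurable f →
      (∀ p, f p ∈ Set.Icc (0 : ℝ) 1) → (∀ a, Integrable (fun ω => f (a, ω)) P) ∧
        Integrable (fun a => ∫ ω, f (a, ω) ∂P) (π.prod (ν.prod υ)) := fun {f} hf hb => by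
    have h1 : ∀ a, Measurable fun ω => f (a, ω) := fun a => hf.comp measurable_prodMk_left
    exact ⟨fun a => integrable_of_mem_Icc_zero_one (h1 a) fun ω => hb _,
      integrable_of_mem_Icc_zero_one (measurable_integral_prodMk P hf) fun a =>
        integral_mem_Icc_zero_one (h1 a) fun ω => hb _⟩
  have hF1 := hω (hlm fun k => 1 - k.1 k.2) fun p => hloss _ _
  have hF2 := hω (hlm fun k => k.1 k.2) fun p => hloss _ _
  have hR := hω hRm fun p => hrisk _
  -- The empirical risk is the average of the selected losses over a uniform column, with the
  -- training set unchanged.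
  have hE : ∀ a : (Fin 2 → Fin n → 𝒵) × (Fin n → Fin 2) × Fin n,
      ∫ ω, empRisk loss (trainingSet a.1 a.2.1) Finset.univ (w' a ω) ∂P
        = ∫ j, ∫ ω, loss (a.1 (a.2.1 j) j) (w' (a.1, a.2.1, j) ω) ∂P ∂υ := fun a => by
    rw [integral_uniformOn_univ, Fintype.card_fin,
      ← integral_finsetSum _ fun j _ => hF2.1 (a.1, a.2.1, j), ← integral_const_mul]
    simp [empRisk, trainingSet, w']
  have hEi : ∀ a : (Fin 2 → Fin n → 𝒵) × (Fin n → Fin 2) × Fin n,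
      Integrable (fun ω => empRisk loss (trainingSet a.1 a.2.1) Finset.univ (w' a ω)) P :=
    fun a => (integrable_finsetSum _ fun j _ => hF2.1 (a.1, a.2.1, j)).const_mul _
  have hsub1 : ∀ a : (Fin 2 → Fin n → 𝒵) × (Fin n → Fin 2) × Fin n,
      ∫ ω, (risk D loss (w' a ω)
          - empRisk loss (trainingSet a.1 a.2.1) Finset.univ (w' a ω)) ∂P
        = ∫ ω, risk D loss (w' a ω) ∂P
          - ∫ j, ∫ ω, loss (a.1 (a.2.1 j) j) (w' (a.1, a.2.1, j) ω) ∂P ∂υ := fun a => by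
    rw [integral_sub (hR.1 a) (hEi a), hE]
  have hsub2 : ∀ a : (Fin 2 → Fin n → 𝒵) × (Fin n → Fin 2) × Fin n,
      ∫ ω, (loss (a.1 (1 - a.2.1 a.2.2) a.2.2) (w' a ω)
          - loss (a.1 (a.2.1 a.2.2) a.2.2) (w' a ω)) ∂P
        = ∫ ω, loss (a.1 (1 - a.2.1 a.2.2) a.2.2) (w' a ω) ∂P
          - ∫ ω, loss (a.1 (a.2.1 a.2.2) a.2.2) (w' a ω) ∂P := fun a =>
    integral_sub (hF1.1 a) (hF2.1 a)
  refine (integral_congr_ae (Filter.Eventually.of_forall hsub1)).trans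
    (Eq.trans ?_ (integral_congr_ae (Filter.Eventually.of_forall hsub2)).symm)
  have hEint : Integrable (fun a : (Fin 2 → Fin n → 𝒵) × (Fin n → Fin 2) × Fin n =>
      ∫ j, ∫ ω, loss (a.1 (a.2.1 j) j) (w' (a.1, a.2.1, j) ω) ∂P ∂υ) (π.prod (ν.prod υ)) := by
    refine Integrable.congr ?_ (Filter.Eventually.of_forall fun a =>
      (integral_uniformOn_univ fun j =>
        ∫ ω, loss (a.1 (a.2.1 j) j) (w' (a.1, a.2.1, j) ω) ∂P).symm)
    refine (integrable_finsetSum _ fun j _ => ?_).const_mul _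
    have hj : Measurable fun a : (Fin 2 → Fin n → 𝒵) × (Fin n → Fin 2) × Fin n =>
        (a.1, a.2.1, j) := by fun_prop
    exact integrable_of_mem_Icc_zero_one
      ((measurable_integral_prodMk P (hlm fun k => k.1 k.2)).comp hj) fun a =>
        integral_mem_Icc_zero_one
          ((hlm fun k => k.1 k.2).comp (measurable_prodMk_left (x := (a.1, a.2.1, j))))
          fun ω => hloss _ _
  rw [integral_sub hR.2 hEint, integral_sub hF1.2 hF2.2]
  congr 1
  · rw [integral_prod_symm _ hR.2, integral_prod_symm _ hF1.2]
    refine integral_congr_ae (Filter.Eventually.of_forall fun k => ?_)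
    obtain ⟨u, j⟩ := k
    have hG : Measurable fun zt : Fin 2 → Fin n → 𝒵 =>
        ∫ ω, loss (zt (1 - u j) j) (w' (zt, u, j) ω) ∂P := by
      have hk : Measurable fun zt : Fin 2 → Fin n → 𝒵 => (zt, u, j) := measurable_prodMk_right
      exact (measurable_integral_prodMk P (hlm fun k => 1 - k.1 k.2)).comp hk
    have hup := measurePreserving_update_update (ι := Fin 2) (κ := Fin n) D (1 - u j) j
    -- The redrawn entry is unselected: a column `i` that selects row `1 - u j` differs from `j`.
    -- The iterate is therefore unaffected, and averaging over the new entry produces the risk.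
    have hS : ∀ (zt : Fin 2 → Fin n → 𝒵) (z : 𝒵), trainingSet (Function.update zt (1 - u j)
        (Function.update (zt (1 - u j)) j z)) u = trainingSet zt u := fun zt z => by
      funext i
      simp only [trainingSet]
      by_cases hi : u i = 1 - u j
      · rw [hi, Function.update_self, Function.update_of_ne]
        rintro rfl
        have h2 : ∀ k : Fin 2, k ≠ 1 - k := by decide
        exact h2 _ hi
      · rw [Function.update_of_ne hi]
    have hGb : ∀ zt : Fin 2 → Fin n → 𝒵,
        ∫ ω, loss (zt (1 - u j) j) (w' (zt, u, j) ω) ∂P ∈ Set.Icc (0 : ℝ) 1 := fun zt =>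
      integral_mem_Icc_zero_one ((hlm fun k => 1 - k.1 k.2).comp
        (measurable_prodMk_left (x := (zt, u, j)))) fun ω => hloss _ _
    have hGi := integrable_of_mem_Icc_zero_one (μ := π.prod D) (hG.comp hup.measurable)
      fun p => hGb _
    have hres := integral_map (μ := π.prod D) hup.measurable.aemeasurable
      (f := fun zt => ∫ ω, loss (zt (1 - u j) j) (w' (zt, u, j) ω) ∂P)
      hG.aestronglyMeasurable
    rw [hup.map_eq] at hres
    simp only
    rw [hres]
    refine Eq.trans ?_ (integral_prod _ hGi).symm
    refine integral_congr_ae (Filter.Eventually.of_forall fun zt => ?_)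
    simp only [Function.comp_apply, w', hS, Function.update_self]
    have hint : Integrable (Function.uncurry fun ω z => loss z (w (trainingSet zt u) ω))
        (P.prod D) := by
      refine integrable_of_mem_Icc_zero_one ?_ fun p => hloss _ _
      have h1 : Measurable fun ω => w (trainingSet zt u) ω := hw.comp measurable_prodMk_left
      exact hloss_meas.comp (measurable_snd.prodMk (h1.comp measurable_fst))
    exact integral_integral_swap hint
  · rw [integral_prod _ hEint, integral_prod _ hF2.2]
    refine integral_congr_ae ?_
    filter_upwards [hEint.prod_right_ae, hF2.2.prod_right_ae] with zt h1 h2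
    rw [integral_prod _ h1, integral_prod _ h2]
    simp [w']

end Resampling

/-! ### The generalization bound -/

section Bound

variable {𝒵 : Type*} [MeasurableSpace 𝒵] {n d : ℕ} {sur : 𝒵 → EuclideanSpace ℝ (Fin d) → ℝ}
  {η β : ℕ → ℝ}

/-- The squared prediction error of `θ` at step `t`, weighted by the squared incoherence, as a
function of the data, the indices, the initial point and the noise. -/
def predictionError (sur : 𝒵 → EuclideanSpace ℝ (Fin d) → ℝ) (η β : ℕ → ℝ) (θ : ℝ → ℝ) (t : ℕ)
    (p : ((Fin 2 → Fin n → 𝒵) × (Fin n → Fin 2) × Fin n) ×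
      EuclideanSpace ℝ (Fin d) × (ℕ → EuclideanSpace ℝ (Fin d))) : ℝ :=
  β t * η t * ‖incoherence sur p.1.1 p.1.2.2
      (ldIterate sur η β (trainingSet p.1.1 p.1.2.1) p.2.1 p.2.2 t)‖ ^ 2 *
    ((if p.1.2.1 p.1.2.2 = 0 then 1 else 0)
      - θ (ldState sur η β p.1.1 p.1.2.1 p.1.2.2 p.2.1 p.2.2 t).2) ^ 2

lemma measurable_ldIterate_trainingSet (hmeas : Measurable (Function.uncurry sur))
    (hsur : ∀ z, Differentiable ℝ (sur z)) (u : Fin n → Fin 2) (t : ℕ) :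
    Measurable fun p : (Fin 2 → Fin n → 𝒵) ×
        EuclideanSpace ℝ (Fin d) × (ℕ → EuclideanSpace ℝ (Fin d)) =>
      ldIterate sur η β (trainingSet p.1 u) p.2.1 p.2.2 t := by
  have h1 : Measurable fun p : (Fin 2 → Fin n → 𝒵) ×
      EuclideanSpace ℝ (Fin d) × (ℕ → EuclideanSpace ℝ (Fin d)) => (trainingSet p.1 u, p.2) :=
    ((measurable_trainingSet u).comp measurable_fst).prodMk measurable_snd
  have h2 := (measurable_ldIterate hmeas hsur η β t).comp h1
  simpa only [Function.comp_def] using h2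

lemma measurable_predictionError (hmeas : Measurable (Function.uncurry sur))
    (hsur : ∀ z, Differentiable ℝ (sur z)) {θ : ℝ → ℝ} (hθ : Measurable θ) (t : ℕ) :
    Measurable (predictionError (n := n) sur η β θ t) := by
  refine measurable_of_forall_index fun k => ?_
  obtain ⟨u, j⟩ := k
  have hld := fun s => measurable_ldIterate_trainingSet (η := η) (β := β) hmeas hsur u s
  have hz : ∀ k : Fin 2, Measurable fun p : (Fin 2 → Fin n → 𝒵) ×
      EuclideanSpace ℝ (Fin d) × (ℕ → EuclideanSpace ℝ (Fin d)) =>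
      (p.1 k j, ldIterate sur η β (trainingSet p.1 u) p.2.1 p.2.2 t) := fun k =>
    ((measurable_pi_apply j).comp ((measurable_pi_apply k).comp measurable_fst)).prodMk (hld t)
  have hg : ∀ k : Fin 2, Measurable fun p : (Fin 2 → Fin n → 𝒵) ×
      EuclideanSpace ℝ (Fin d) × (ℕ → EuclideanSpace ℝ (Fin d)) =>
      ∇ (sur (p.1 k j)) (ldIterate sur η β (trainingSet p.1 u) p.2.1 p.2.2 t) := fun k => by
    have h := (measurable_gradient hmeas hsur).comp (hz k)
    simpa only [Function.comp_def] using h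
  have hpath : Measurable fun p : (Fin 2 → Fin n → 𝒵) ×
      EuclideanSpace ℝ (Fin d) × (ℕ → EuclideanSpace ℝ (Fin d)) =>
      (p.1, fun s => ldIterate sur η β (trainingSet p.1 u) p.2.1 p.2.2 s) :=
    measurable_fst.prodMk (measurable_pi_lambda _ hld)
  have hst : ∀ k : Fin 2, Measurable fun p : (Fin 2 → Fin n → 𝒵) ×
      EuclideanSpace ℝ (Fin d) × (ℕ → EuclideanSpace ℝ (Fin d)) =>
      testStat sur η β p.1 u j (ldIterate sur η β (trainingSet p.1 u) p.2.1 p.2.2) t k :=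
    fun k => by
      have h := (measurable_testStat hmeas hsur η β u j t k).comp hpath
      simpa only [Function.comp_def] using h
  have hsub := hθ.comp ((hst 1).sub (hst 0))
  exact ((((hg 0).sub (hg 1)).norm.pow_const 2).const_mul (β t * η t)).mul
    ((hsub.const_sub (if u j = 0 then 1 else 0)).pow_const 2)

variable {Ω : Type*} [MeasurableSpace Ω] {P : Measure Ω}
  {D : Measure 𝒵} {Zt : Ω → Fin 2 → Fin n → 𝒵} {U : Ω → Fin n → Fin 2}
  {J : Ω → Fin n} {W₀ : Ω → EuclideanSpace ℝ (Fin d)} {ε : ℕ → Ω → EuclideanSpace ℝ (Fin d)}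

namespace IsLDModel

lemma measurable_noise (h : IsLDModel P D Zt U J W₀ ε) :
    Measurable fun ω => (W₀ ω, fun t => ε t ω) :=
  h.measurable_W₀.prodMk (measurable_pi_lambda _ h.measurable_ε)

lemma measurable_data (h : IsLDModel P D Zt U J W₀ ε) :
    Measurable fun ω => (Zt ω, U ω, J ω) :=
  h.measurable_Zt.prodMk (h.measurable_U.prodMk h.measurable_J)

variable [IsProbabilityMeasure P]

lemma indepFun_data_noise (h : IsLDModel P D Zt U J W₀ ε) :
    IndepFun (fun ω => (Zt ω, U ω, J ω)) (fun ω => (W₀ ω, fun t => ε t ω)) P := by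
  have hUJ : IndepFun (fun ω => (U ω, J ω)) (fun ω => (W₀ ω, fun t => ε t ω)) P :=
    indepFun_prodMk_of_indepFun h.measurable_U h.measurable_J h.measurable_noise h.indep_U h.indep_J
  have hZ : IndepFun Zt (fun ω => ((U ω, J ω), (W₀ ω, fun t => ε t ω))) P :=
    h.indep_Zt.comp (φ := id) (ψ := fun p : (Fin n → Fin 2) × Fin n × EuclideanSpace ℝ (Fin d) ×
      (ℕ → EuclideanSpace ℝ (Fin d)) => ((p.1, p.2.1), p.2.2)) measurable_id (by fun_prop)
  exact indepFun_prodMk_of_indepFun h.measurable_Zt (h.measurable_U.prodMk h.measurable_J)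
    h.measurable_noise hZ hUJ

lemma map_data (h : IsLDModel P D Zt U J W₀ ε) :
    P.map (fun ω => (Zt ω, U ω, J ω))
      = (Measure.pi fun _ => Measure.pi fun _ => D).prod
        ((uniformOn Set.univ).prod (uniformOn Set.univ)) := by
  have hUJ : IndepFun U J P := h.indep_U.comp (φ := id) (ψ := fun p : Fin n ×
    EuclideanSpace ℝ (Fin d) × (ℕ → EuclideanSpace ℝ (Fin d)) => p.1) measurable_id measurable_fst
  have hZ : IndepFun Zt (fun ω => (U ω, J ω)) P :=
    h.indep_Zt.comp (φ := id) (ψ := fun p : (Fin n → Fin 2) × Fin n × EuclideanSpace ℝ (Fin d) ×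
      (ℕ → EuclideanSpace ℝ (Fin d)) => (p.1, p.2.1)) measurable_id (by fun_prop)
  rw [(indepFun_iff_map_prod_eq_prod_map_map h.measurable_Zt.aemeasurable
      (h.measurable_U.prodMk h.measurable_J).aemeasurable).1 hZ,
    (indepFun_iff_map_prod_eq_prod_map_map h.measurable_U.aemeasurable
      h.measurable_J.aemeasurable).1 hUJ, h.law_Zt, h.law_U, h.law_J]

/-- The comparison of the two dynamics whose selections differ in column `j` only. -/
lemma ofReal_add_flipAt_le (h : IsLDModel P D Zt U J W₀ ε) (hn : 0 < n)
    (hmeas : Measurable (Function.uncurry sur)) (hsur : ∀ z, Differentiable ℝ (sur z)) {T : ℕ}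
    (hη : ∀ t < T, 0 < η t) (hβ : ∀ t < T, 0 < β t) {θ : ℝ → ℝ} (hθ : Measurable θ)
    {loss : 𝒵 → EuclideanSpace ℝ (Fin d) → ℝ} (hloss_meas : Measurable (Function.uncurry loss))
    (hloss : ∀ z w, loss z w ∈ Set.Icc (0 : ℝ) 1)
    (zt : Fin 2 → Fin n → 𝒵) (u : Fin n → Fin 2) (j : Fin n) :
    ENNReal.ofReal
        (∫ ω, (loss (zt (1 - u j) j)
              (ldIterate sur η β (trainingSet zt u) (W₀ ω) (fun t => ε t ω) T)
            - loss (zt (u j) j)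
              (ldIterate sur η β (trainingSet zt u) (W₀ ω) (fun t => ε t ω) T)) ∂P
          + ∫ ω, (loss (zt (1 - flipAt j u j) j)
              (ldIterate sur η β (trainingSet zt (flipAt j u)) (W₀ ω) (fun t => ε t ω) T)
            - loss (zt (flipAt j u j) j)
              (ldIterate sur η β (trainingSet zt (flipAt j u)) (W₀ ω) (fun t => ε t ω) T)) ∂P)
      ≤ ENNReal.ofReal (1 / (n * √2)) * (∑ t ∈ Finset.range T, ∫⁻ ω, ENNReal.ofReal
            (predictionError sur η β θ t ((zt, u, j), W₀ ω, fun t => ε t ω)) ∂P) ^ (1 / 2 : ℝ)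
        + ENNReal.ofReal (1 / (n * √2)) * (∑ t ∈ Finset.range T, ∫⁻ ω, ENNReal.ofReal
            (predictionError sur η β θ t ((zt, flipAt j u, j), W₀ ω, fun t => ε t ω)) ∂P)
              ^ (1 / 2 : ℝ) := by
  have hk : flipAt j u j = 1 - u j := Function.update_self ..
  have hk' : 1 - flipAt j u j = u j := by
    have h2 : ∀ k : Fin 2, 1 - (1 - k) = k := by decide
    rw [hk, h2]
  set f : EuclideanSpace ℝ (Fin d) → ℝ :=
    fun w => loss (zt (1 - u j) j) w - loss (zt (u j) j) w
  have hfm : Measurable f := (hloss_meas.comp (measurable_prodMk_left (x := zt (1 - u j) j))).sub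
    (hloss_meas.comp (measurable_prodMk_left (x := zt (u j) j)))
  have hf1 : ∀ w, |f w| ≤ 1 := fun w => by
    have h1 := hloss (zt (1 - u j) j) w
    have h2 := hloss (zt (u j) j) w
    exact abs_le.2 ⟨by simp only [f]; linarith [h1.1, h2.2], by simp only [f]; linarith [h1.2, h2.1]⟩
  have key := fun (u : Fin n → Fin 2) {f : EuclideanSpace ℝ (Fin d) → ℝ} (hf : Measurable f)
      (hf1 : ∀ w, |f w| ≤ 1) => ofReal_integral_ldIterate_sub_le hn hmeas hsur hη hβ
    h.measurable_W₀ h.measurable_ε h.law_ε h.indep_ε h.indep_W₀ hθ zt u j hf hf1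
  have k1 := key u hfm hf1
  -- Under the flip the selected and unselected entries exchange roles, so the second comparison
  -- uses `-f`.
  have k2 := key (flipAt j u) (f := fun w => -f w) hfm.neg fun w => by rw [abs_neg]; exact hf1 w
  -- The reduced risk ignores the selection in column `j`. Hence both comparisons have the same
  -- reference dynamics, and its expectations of `f` and `-f` cancel.
  have hq : empRisk sur (trainingSet zt (flipAt j u)) (Finset.univ.erase j)
      = empRisk sur (trainingSet zt u) (Finset.univ.erase j) :=
    empRisk_congr fun i hi => by
      rw [trainingSet, trainingSet, flipAt, Function.update_of_ne (Finset.ne_of_mem_erase hi)]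
  rw [hq] at k2
  simp only [integral_neg] at k2
  have e1 : ∫ ω, (loss (zt (1 - flipAt j u j) j)
          (ldIterate sur η β (trainingSet zt (flipAt j u)) (W₀ ω) (fun t => ε t ω) T)
        - loss (zt (flipAt j u j) j)
          (ldIterate sur η β (trainingSet zt (flipAt j u)) (W₀ ω) (fun t => ε t ω) T)) ∂P
      = -∫ ω, f (ldIterate sur η β (trainingSet zt (flipAt j u)) (W₀ ω) (fun t => ε t ω) T) ∂P := by
    rw [hk', hk, ← integral_neg]
    simp [f]
  rw [e1]
  refine le_trans (le_trans (ENNReal.ofReal_le_ofReal (le_of_eq ?_)) ENNReal.ofReal_add_le)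
    (add_le_add k1 k2)
  simp only [f]
  ring

/-- The generalization bound for a fixed decision function. -/
lemma ofReal_integral_le [IsProbabilityMeasure D] (h : IsLDModel P D Zt U J W₀ ε) (hn : 0 < n)
    {loss : 𝒵 → EuclideanSpace ℝ (Fin d) → ℝ} (hloss_meas : Measurable (Function.uncurry loss))
    (hloss : ∀ z w, loss z w ∈ Set.Icc (0 : ℝ) 1)
    (hmeas : Measurable (Function.uncurry sur)) (hsur : ∀ z, Differentiable ℝ (sur z)) {T : ℕ}
    (hη : ∀ t < T, 0 < η t) (hβ : ∀ t < T, 0 < β t) {θ : ℝ → ℝ} (hθ : Measurable θ) :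
    ENNReal.ofReal (∫ ω, (risk D loss
          (ldIterate sur η β (trainingSet (Zt ω) (U ω)) (W₀ ω) (fun s => ε s ω) T)
        - empRisk loss (trainingSet (Zt ω) (U ω)) Finset.univ
          (ldIterate sur η β (trainingSet (Zt ω) (U ω)) (W₀ ω) (fun s => ε s ω) T)) ∂P)
      ≤ ENNReal.ofReal (1 / (n * √2)) *
        ∫⁻ ω, (∑ t ∈ Finset.range T,
            (P⁻[fun ω' => ENNReal.ofReal (predictionError sur η β θ t
                ((Zt ω', U ω', J ω'), W₀ ω', fun s => ε s ω'))
              | MeasurableSpace.comap (fun ω' => (Zt ω', U ω', J ω')) inferInstance]) ω)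
            ^ (1 / 2 : ℝ) ∂P := by
  have : Nonempty (Fin n) := ⟨⟨0, hn⟩⟩
  set A : Ω → (Fin 2 → Fin n → 𝒵) × (Fin n → Fin 2) × Fin n := fun ω => (Zt ω, U ω, J ω)
  set N : Ω → EuclideanSpace ℝ (Fin d) × (ℕ → EuclideanSpace ℝ (Fin d)) :=
    fun ω => (W₀ ω, fun t => ε t ω)
  have hA : Measurable A := h.measurable_data
  have hN : Measurable N := h.measurable_noise
  have hAN : IndepFun A N P := h.indepFun_data_noise
  set f : ℕ → ((Fin 2 → Fin n → 𝒵) × (Fin n → Fin 2) × Fin n) ×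
      EuclideanSpace ℝ (Fin d) × (ℕ → EuclideanSpace ℝ (Fin d)) → ℝ≥0∞ :=
    fun t p => ENNReal.ofReal (predictionError sur η β θ t p)
  have hf : ∀ t, Measurable (f t) := fun t =>
    (measurable_predictionError hmeas hsur hθ t).ennreal_ofReal
  have hpair : Measurable fun p : ((Fin 2 → Fin n → 𝒵) × (Fin n → Fin 2) × Fin n) × Ω =>
      (p.1, N p.2) := measurable_fst.prodMk (hN.comp measurable_snd)
  set r : (Fin 2 → Fin n → 𝒵) × (Fin n → Fin 2) × Fin n → ℝ≥0∞ := fun a =>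
    (∑ t ∈ Finset.range T, ∫⁻ ω', f t (a, N ω') ∂P) ^ (1 / 2 : ℝ)
  have hr : Measurable r := by
    refine Measurable.pow_const (Finset.measurable_fun_sum _ fun t _ => ?_) _
    exact ((hf t).comp hpair).lintegral_prod_right'
  -- One null set serves all `t`; off it, each conditional expectation is the integral over initial
  -- point and noise with the data frozen, as in `r`.
  have hcond : ∀ᵐ ω ∂P, ∀ t, (P⁻[fun ω' => f t (A ω', N ω')
      | MeasurableSpace.comap A inferInstance]) ω = ∫⁻ ω', f t (A ω, N ω') ∂P :=
    ae_all_iff.2 fun t => condLExp_comp_prod_of_indepFun hA hN hAN (hf t)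
  have hrhs : ∫⁻ ω, (∑ t ∈ Finset.range T, (P⁻[fun ω' => f t (A ω', N ω')
      | MeasurableSpace.comap A inferInstance]) ω) ^ (1 / 2 : ℝ) ∂P = ∫⁻ a, r a ∂(P.map A) := by
    rw [lintegral_map hr hA]
    refine lintegral_congr_ae ?_
    filter_upwards [hcond] with ω hω
    simp only [r, hω]
  have hrisk : ∀ w, risk D loss w ∈ Set.Icc (0 : ℝ) 1 := fun x =>
    integral_mem_Icc_zero_one (hloss_meas.comp measurable_prodMk_right) fun z => hloss z x
  have hemp : ∀ (s : Fin n → 𝒵) w, empRisk loss s Finset.univ w ∈ Set.Icc (0 : ℝ) 1 :=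
    fun s w => by
      have e : empRisk loss s Finset.univ w
          = ∫ i, loss (s i) w ∂(uniformOn (Set.univ : Set (Fin n))) := by
        rw [integral_uniformOn_univ]
        rfl
      rw [e]
      exact integral_mem_Icc_zero_one (measurable_of_finite _) fun i => hloss _ _
  have hriskm : Measurable (risk D loss) := by
    have h1 : Measurable fun p : EuclideanSpace ℝ (Fin d) × 𝒵 => loss p.2 p.1 :=
      hloss_meas.comp measurable_swap
    exact measurable_integral_prodMk D h1
  set g : ((Fin 2 → Fin n → 𝒵) × (Fin n → Fin 2) × Fin n) ×
      EuclideanSpace ℝ (Fin d) × (ℕ → EuclideanSpace ℝ (Fin d)) → ℝ :=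
    fun p => risk D loss (ldIterate sur η β (trainingSet p.1.1 p.1.2.1) p.2.1 p.2.2 T)
      - empRisk loss (trainingSet p.1.1 p.1.2.1) Finset.univ
          (ldIterate sur η β (trainingSet p.1.1 p.1.2.1) p.2.1 p.2.2 T)
  have hg : Measurable g := by
    refine measurable_of_forall_index fun k => ?_
    have hld := measurable_ldIterate_trainingSet (η := η) (β := β) hmeas hsur k.1 T
    have hi : ∀ i : Fin n, Measurable fun p : (Fin 2 → Fin n → 𝒵) ×
        EuclideanSpace ℝ (Fin d) × (ℕ → EuclideanSpace ℝ (Fin d)) =>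
        loss (trainingSet p.1 k.1 i)
          (ldIterate sur η β (trainingSet p.1 k.1) p.2.1 p.2.2 T) := fun i => by
      have hp := (((measurable_pi_apply i).comp
        ((measurable_trainingSet k.1).comp measurable_fst)).prodMk hld)
      exact hloss_meas.comp hp
    exact (hriskm.comp hld).sub
      ((Finset.measurable_fun_sum Finset.univ fun i _ => hi i).const_mul _)
  have hgb : ∀ p, |g p| ≤ 1 := fun p => by
    have h1 := hrisk (ldIterate sur η β (trainingSet p.1.1 p.1.2.1) p.2.1 p.2.2 T)
    have h2 := hemp (trainingSet p.1.1 p.1.2.1)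
      (ldIterate sur η β (trainingSet p.1.1 p.1.2.1) p.2.1 p.2.2 T)
    exact abs_le.2 ⟨by simp only [g]; linarith [h1.1, h2.2], by simp only [g]; linarith [h1.2, h2.1]⟩
  have hgN : ∀ a, ∫ y, g (a, y) ∂(P.map N) = ∫ ω', g (a, N ω') ∂P := fun a =>
    integral_map hN.aemeasurable (hg.comp measurable_prodMk_left).aestronglyMeasurable
  have hlhs : ∫ ω, g (A ω, N ω) ∂P = ∫ a, ∫ ω', g (a, N ω') ∂P ∂(P.map A) := by
    rw [integral_comp_prod_of_indepFun hA hN hAN hg hgb]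
    simp_rw [hgN]
    exact (integral_map hA.aemeasurable
      (measurable_integral_prodMk P (hg.comp hpair)).aestronglyMeasurable).symm
  have hw : Measurable (Function.uncurry fun (s : Fin n → 𝒵) ω =>
      ldIterate sur η β s (W₀ ω) (fun t => ε t ω) T) := by
    have hp : Measurable fun p : (Fin n → 𝒵) × Ω => (p.1, N p.2) :=
      measurable_fst.prodMk (hN.comp measurable_snd)
    exact (measurable_ldIterate hmeas hsur η β T).comp hp
  have hlm : ∀ v : (Fin n → Fin 2) × Fin n → Fin 2,
      Measurable fun p : ((Fin 2 → Fin n → 𝒵) × (Fin n → Fin 2) × Fin n) × Ω =>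
        loss (p.1.1 (v p.1.2) p.1.2.2)
          (ldIterate sur η β (trainingSet p.1.1 p.1.2.1) (W₀ p.2) (fun t => ε t p.2) T) := by
    refine fun v => measurable_of_forall_index fun k => ?_
    have h1 : Measurable fun p : (Fin 2 → Fin n → 𝒵) × Ω => p.1 (v k) k.2 :=
      (measurable_pi_apply k.2).comp ((measurable_pi_apply (v k)).comp measurable_fst)
    have h2 : Measurable fun p : (Fin 2 → Fin n → 𝒵) × Ω => (trainingSet p.1 k.1, p.2) :=
      ((measurable_trainingSet k.1).comp measurable_fst).prodMk measurable_snd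
    exact hloss_meas.comp (h1.prodMk (hw.comp h2))
  have hgen := integral_risk_sub_empRisk P D hn hloss_meas hloss hw (uniformOn Set.univ)
  refine le_trans (le_of_eq (congrArg ENNReal.ofReal (hlhs.trans ?_))) (le_trans
    (ofReal_integral_le_of_symm (measurePreserving_flipAt (n := n)
      (Measure.pi fun _ : Fin 2 => Measure.pi fun _ : Fin n => D) (uniformOn Set.univ))
      ?_ (hr.const_mul (ENNReal.ofReal (1 / (n * √2))))
      fun a => h.ofReal_add_flipAt_le hn hmeas hsur hη hβ hθ hloss_meas hloss a.1 a.2.1 a.2.2)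
    (le_of_eq ?_))
  · rw [h.map_data]
    exact hgen
  · refine Integrable.of_bound (measurable_integral_prodMk P
      ((hlm fun k => 1 - k.1 k.2).sub (hlm fun k => k.1 k.2))).aestronglyMeasurable 1
      (Filter.Eventually.of_forall fun a => ?_)
    refine (norm_integral_le_of_norm_le_const (C := 1)
      (Filter.Eventually.of_forall fun ω => ?_)).trans (by simp)
    exact abs_le.2 ⟨by linarith [(hloss (a.1 (1 - a.2.1 a.2.2) a.2.2) (ldIterate sur η β
        (trainingSet a.1 a.2.1) (W₀ ω) (fun t => ε t ω) T)).1, (hloss (a.1 (a.2.1 a.2.2) a.2.2)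
        (ldIterate sur η β (trainingSet a.1 a.2.1) (W₀ ω) (fun t => ε t ω) T)).2],
      by linarith [(hloss (a.1 (1 - a.2.1 a.2.2) a.2.2) (ldIterate sur η β
        (trainingSet a.1 a.2.1) (W₀ ω) (fun t => ε t ω) T)).2, (hloss (a.1 (a.2.1 a.2.2) a.2.2)
        (ldIterate sur η β (trainingSet a.1 a.2.1) (W₀ ω) (fun t => ε t ω) T)).1]⟩
  · rw [lintegral_const_mul _ hr, ← h.map_data]
    exact congrArg _ hrhs.symm

end IsLDModel

end Bound

end LangevinGen

end

theorem mainTheorem7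
    {Ω 𝒵 : Type*} [MeasurableSpace Ω] [MeasurableSpace 𝒵]
    (P : Measure Ω) [IsProbabilityMeasure P] (D : Measure 𝒵) [IsProbabilityMeasure D]
    (n d T : ℕ) (hn : 0 < n)
    (loss : 𝒵 → EuclideanSpace ℝ (Fin d) → ℝ)
    (hloss_meas : Measurable (Function.uncurry loss))
    (hloss : ∀ z w, loss z w ∈ Set.Icc (0 : ℝ) 1)
    (sur : 𝒵 → EuclideanSpace ℝ (Fin d) → ℝ)
    (hsur_meas : Measurable (Function.uncurry sur))
    (hsur : ∀ z, Differentiable ℝ (sur z))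
    (η β : ℕ → ℝ) (hη : ∀ t < T, 0 < η t) (hβ : ∀ t < T, 0 < β t)
    (Zt : Ω → Fin 2 → Fin n → 𝒵) (U : Ω → Fin n → Fin 2) (J : Ω → Fin n)
    (W₀ : Ω → EuclideanSpace ℝ (Fin d)) (ε : ℕ → Ω → EuclideanSpace ℝ (Fin d))
    (hmodel : LangevinGen.IsLDModel P D Zt U J W₀ ε)
    (S : Ω → Fin n → 𝒵) (hS : ∀ ω, S ω = LangevinGen.trainingSet (Zt ω) (U ω))
    (W : ℕ → Ω → EuclideanSpace ℝ (Fin d))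
    (hW : ∀ t ω, W t ω = LangevinGen.ldIterate sur η β (S ω) (W₀ ω) (fun s => ε s ω) t)
    (ζ : ℕ → Ω → EuclideanSpace ℝ (Fin d))
    (hζ : ∀ t ω, ζ t ω = LangevinGen.incoherence sur (Zt ω) (J ω) (W t ω))
    (Y : ℕ → Fin 2 → Ω → ℝ)
    (hY : ∀ t k ω,
      Y t k ω = LangevinGen.testStat sur η β (Zt ω) (U ω) (J ω) (fun s => W s ω) t k) :
    ((∫ ω, (LangevinGen.risk D loss (W T ω)
        - LangevinGen.empRisk loss (S ω) Finset.univ (W T ω)) ∂P : ℝ) : EReal) ≤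
      ((ENNReal.ofReal (1 / (n * √2)) *
        ⨅ θ ∈ LangevinGen.decisionFunctions,
          ∫⁻ ω, (∑ t ∈ Finset.range T,
            (P⁻[fun ω' => ENNReal.ofReal (β t * η t * ‖ζ t ω'‖ ^ 2 *
                ((if U ω' (J ω') = 0 then 1 else 0) - θ (Y t 1 ω' - Y t 0 ω')) ^ 2)
              | MeasurableSpace.comap (fun ω' => (Zt ω', U ω', J ω')) inferInstance]) ω)
            ^ (1 / 2 : ℝ) ∂P : ℝ≥0∞) : EReal) := by
  have hnr : (0 : ℝ) < n := Nat.cast_pos.2 hn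
  have hC : ENNReal.ofReal (1 / (n * √2)) ≠ 0 := (ENNReal.ofReal_pos.2 (by positivity)).ne'
  have hYs : ∀ t ω, Y t 1 ω - Y t 0 ω = (LangevinGen.ldState sur η β (Zt ω) (U ω) (J ω) (W₀ ω)
      (fun s => ε s ω) t).2 := fun t ω => by
    simp only [hY, hW, hS]
    rfl
  obtain rfl : S = fun ω => LangevinGen.trainingSet (Zt ω) (U ω) := funext hS
  have hWeq : W = fun t ω => LangevinGen.ldIterate sur η β
      (LangevinGen.trainingSet (Zt ω) (U ω)) (W₀ ω) (fun s => ε s ω) t :=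
    funext fun t => funext fun ω => hW t ω
  have hζeq : ζ = fun t ω => LangevinGen.incoherence sur (Zt ω) (J ω) (W t ω) :=
    funext fun t => funext fun ω => hζ t ω
  subst hζeq
  subst hWeq
  suffices H : ∀ θ ∈ LangevinGen.decisionFunctions,
      ENNReal.ofReal (∫ ω, (LangevinGen.risk D loss (LangevinGen.ldIterate sur η β
          (LangevinGen.trainingSet (Zt ω) (U ω)) (W₀ ω) (fun s => ε s ω) T)
        - LangevinGen.empRisk loss (LangevinGen.trainingSet (Zt ω) (U ω)) Finset.univ
          (LangevinGen.ldIterate sur η β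
            (LangevinGen.trainingSet (Zt ω) (U ω)) (W₀ ω) (fun s => ε s ω) T)) ∂P)
      ≤ ENNReal.ofReal (1 / (n * √2)) *
        ∫⁻ ω, (∑ t ∈ Finset.range T,
            (P⁻[fun ω' => ENNReal.ofReal (LangevinGen.predictionError sur η β θ t
                ((Zt ω', U ω', J ω'), W₀ ω', fun s => ε s ω'))
              | MeasurableSpace.comap (fun ω' => (Zt ω', U ω', J ω')) inferInstance]) ω)
            ^ (1 / 2 : ℝ) ∂P by
    -- The constant is positive and finite, so it passes through both infima, over `θ` and over the
    -- membership proof; the latter is `∞` for inadmissible `θ`.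
    rw [ENNReal.mul_iInf_of_ne hC ENNReal.ofReal_ne_top]
    simp_rw [ENNReal.mul_iInf_of_ne hC ENNReal.ofReal_ne_top]
    -- The expected gap may be negative; it is at most its positive part, which is what
    -- `ENNReal.ofReal` records.
    refine le_trans (le_trans (le_max_left _ 0) EReal.coe_ennreal_ofReal.ge)
      (EReal.coe_ennreal_le_coe_ennreal_iff.2 (le_iInf₂ fun θ hθ => ?_))
    refine (H θ hθ).trans (le_of_eq ?_)
    simp only [hYs]
    rfl
  rintro θ ⟨hθ, -⟩
  exact hmodel.ofReal_integral_le hn hloss_meas hloss hsur_meas hsur hη hβ hθ
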